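/- Let $T>0$ and $L>0$. Put $\mathcal Z=\mathbb Z^2\setminus\{0\}$ and, for $k\in\mathcal Z$, $\mu_k=(2\pi|k|/L)^2$ with $|k|$ the Euclidean length. Let $e_k(x)=\omega_{k_1}(x_1)\,\omega_{k_2}(x_2)$ be the real trigonometric orthonormal system of $L^2([0,L]^2)$, where $\omega_m(z)=\sqrt{2/L}\,\sin(2\pi m z/L)$ for $m>0$, $\omega_0=1/\sqrt L$, and $\omega_m(z)=\sqrt{2/L}\,\cos(2\pi m z/L)$ for $m<0$. Let $(\beta_k)_{k\in\mathcal Z}$ be independent standard real Brownian motions on a probability space $(\Omega,\mathbb P)$, and let $Z_k(t)=\int_0^t e^{-(t-s)\mu_k^2}\,d\beta_k(s)$ (Wiener integral). Let $(\alpha_k^{(\varepsilon)})_{k\in\mathcal Z,\ \varepsilon>0}$ be real numbers that are bounded uniformly in $k$ and $\varepsilon$, depend on $k$ only through $|k|$, satisfy $\alpha_k^{(\varepsilon)}\to1$ as $\varepsilon\to0$ for every $k$, and, for every $\varepsilon>0$, satisfy $\alpha^{(\varepsilon)}_k=O(|k|^{-\gamma(\varepsilon)})$ for some $\gamma(\varepsilon)>0$.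 Define, for $(t,x)\in[0,T]\times[0,L]^2$, $$Z(t,x)=\sum_{k\in\mathcal Z}Z_k(t)\,e_k(x),\qquad Z_\varepsilon(t,x)=\sum_{k\in\mathcal Z}\alpha_k^{(\varepsilon)}Z_k(t)\,e_k(x).$$ Then the Wiener integrals $Z_k(t)$ exist, both series converge in $L^2(\Omega)$ at every point $(t,x)\in[0,T]\times[0,L]^2$, and $Z$ and, for every $\varepsilon>0$, $Z_\varepsilon$ have versions with continuous sample functions on $[0,T]\times[0,L]^2$ which belong to $L^p(\Omega;C^0([0,T]\times[0,L]^2))$ for every $p\in[1,\infty)$. Moreover, for every $\delta\in(0,1/4)$ and $p\in[1,\infty)$ there is a constant $C$ depending only on $p$, $\delta$, $T$ and $L$ such that, for every $\varepsilon>0$, $$\mathbb E\,\|Z_\varepsilon\|_{C^0([0,T]\times[0,L]^2)}^p\le C\Big(\sum_{k\in\mathcal Z}\big(\alpha_k^{(\varepsilon)}\big)^2\mu_k^{4\delta-2}\Big)^{p/2}<\infty .$$ -/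

import Mathlib

open MeasureTheory ProbabilityTheory Filter Topology
open scoped NNReal ENNReal

noncomputable section

namespace SurfaceGrowth

/-! ### Fourier modes on the square `[0,L]²` -/

/-- The nonzero lattice points of `ℤ²`. -/
abbrev Mode : Type := {k : ℤ × ℤ // k ≠ 0}

/-- The Euclidean length `|k|` of a mode. -/
def Mode.abs (k : Mode) : ℝ := Real.sqrt ((k.1.1 : ℝ) ^ 2 + (k.1.2 : ℝ) ^ 2)

/-- The eigenvalue `μ_k = (2π|k|/L)²` of `-Δ` on the torus of side `L`. -/
def eigenvalue (L : ℝ) (k : Mode) : ℝ := (2 * Real.pi * k.abs / L) ^ 2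

/-- The one-dimensional real trigonometric orthonormal basis of `L²([0,L])`. -/
def trigBasis (L : ℝ) (m : ℤ) (z : ℝ) : ℝ :=
  if 0 < m then Real.sqrt (2 / L) * Real.sin (2 * Real.pi * m * z / L)
  else if m = 0 then 1 / Real.sqrt L
  else Real.sqrt (2 / L) * Real.cos (2 * Real.pi * m * z / L)

/-- `e_k(x) = ω_{k₁}(x₁) ω_{k₂}(x₂)`. -/
def eigenfunction (L : ℝ) (k : Mode) (x₁ x₂ : ℝ) : ℝ :=
  trigBasis L k.1.1 x₁ * trigBasis L k.1.2 x₂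

/-! ### The Wiener integral of a deterministic function -/

/-- Step functions `∑_{i<n} c_i 1_{(τ_i, τ_{i+1}]}` on `[0,t]`. -/
structure StepFunction (t : ℝ≥0) where
  n : ℕ
  τ : ℕ → ℝ≥0
  mono : Monotone τ
  le_t : ∀ i, τ i ≤ t
  c : ℕ → ℝ

/-- The step function as a function on the real line. -/
def StepFunction.eval {t : ℝ≥0} (φ : StepFunction t) (s : ℝ) : ℝ :=
  ∑ i ∈ Finset.range φ.n,
    (Set.Ioc (φ.τ i : ℝ) (φ.τ (i + 1) : ℝ)).indicator (fun _ => φ.c i) s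

/-- The elementary integral `∑_{i<n} c_i (B(τ_{i+1}) - B(τ_i))`. -/
def StepFunction.wiener {Ω : Type*} {t : ℝ≥0} (φ : StepFunction t)
    (B : ℝ≥0 → Ω → ℝ) (ω : Ω) : ℝ :=
  ∑ i ∈ Finset.range φ.n, φ.c i * (B (φ.τ (i + 1)) ω - B (φ.τ i) ω)

/-- `I = ∫₀ᵗ f dB`: `I` is the limit in `L²(Ω)` of the elementary integrals of some sequence of
step functions that converges to `f` in `L²(0,t)`. -/
def IsWienerIntegral {Ω : Type*} [MeasurableSpace Ω] (P : Measure Ω) (B : ℝ≥0 → Ω → ℝ)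
    (t : ℝ≥0) (f : ℝ → ℝ) (I : Ω → ℝ) : Prop :=
  MemLp I 2 P ∧
  ∃ φ : ℕ → StepFunction t,
    Tendsto (fun n => eLpNorm (fun s => (φ n).eval s - f s) 2
      (volume.restrict (Set.Ioc 0 (t : ℝ)))) atTop (𝓝 0) ∧
    Tendsto (fun n => eLpNorm (fun ω => (φ n).wiener B ω - I ω) 2 P) atTop (𝓝 0)

open scoped Classical in
/-- The Wiener integral `∫₀ᵗ f dB` as a random variable (determined up to null sets). -/
def wienerIntegral {Ω : Type*} [MeasurableSpace Ω] (P : Measure Ω) (B : ℝ≥0 → Ω → ℝ)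
    (t : ℝ≥0) (f : ℝ → ℝ) : Ω → ℝ :=
  if h : ∃ I : Ω → ℝ, IsWienerIntegral P B t f I then h.choose else 0

/-! ### The stochastic convolution -/

/-- The kernel `s ↦ exp(-(t-s) μ_k²)`. -/
def kernel (L : ℝ) (k : Mode) (t : ℝ≥0) (s : ℝ) : ℝ :=
  Real.exp (-((t : ℝ) - s) * eigenvalue L k ^ 2)

/-- The Fourier coefficient `Z_k(t) = ∫₀ᵗ exp(-(t-s) μ_k²) dβ_k(s)`. -/
def convMode {Ω : Type*} [MeasurableSpace Ω] (P : Measure Ω) (L : ℝ)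
    (β : Mode → ℝ≥0 → Ω → ℝ) (k : Mode) (t : ℝ≥0) : Ω → ℝ :=
  wienerIntegral P (β k) t (kernel L k t)

/-- `S = ∑_k f_k` (unconditionally) in `L²(Ω)`. -/
def HasL2Sum {Ω ι : Type*} [MeasurableSpace Ω] (P : Measure Ω) (f : ι → Ω → ℝ)
    (S : Ω → ℝ) : Prop :=
  (∀ k, MemLp (f k) 2 P) ∧ MemLp S 2 P ∧
  Tendsto (fun F : Finset ι => eLpNorm (fun ω => (∑ k ∈ F, f k ω) - S ω) 2 P) atTop (𝓝 0)

/-- The compact space-time domain `[0,T] × [0,L]²`. -/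
abbrev SpaceTime (T L : ℝ) : Type :=
  Set.Icc (0 : ℝ) T × Set.Icc (0 : ℝ) L × Set.Icc (0 : ℝ) L

/-- `Y` is a version with continuous sample functions of the random field
`(t,x) ↦ ∑_k a_k Z_k(t) e_k(x)` on `[0,T] × [0,L]²`, the series being taken in `L²(Ω)` at each
space-time point. -/
def IsContinuousVersion {Ω : Type*} [MeasurableSpace Ω] (P : Measure Ω) (T L : ℝ)
    (β : Mode → ℝ≥0 → Ω → ℝ) (a : Mode → ℝ) (Y : Ω → C(SpaceTime T L, ℝ)) : Prop :=
  ∀ q : SpaceTime T L,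
    HasL2Sum P
      (fun (k : Mode) ω => a k * convMode P L β k (q.1 : ℝ).toNNReal ω *
        eigenfunction L k q.2.1 q.2.2)
      (fun ω => Y ω q)

/-- Admissible regularizations `(α_k^{(ε)})`, `ε > 0`, of the noise. -/
structure IsRegularization (α : ℝ → Mode → ℝ) : Prop where
  bounded : ∃ M : ℝ, ∀ ε, 0 < ε → ∀ k, |α ε k| ≤ M
  decay : ∀ ε, 0 < ε → ∃ γ : ℝ, 0 < γ ∧ ∃ K : ℝ, ∀ k, |α ε k| ≤ K * k.abs ^ (-γ)
  tendsto_one : ∀ k, Tendsto (fun ε => α ε k) (𝓝[>] 0) (𝓝 1)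
  radial : ∀ ε, 0 < ε → ∀ k l : Mode, k.abs = l.abs → α ε k = α ε l

end SurfaceGrowth

end

noncomputable section

namespace SurfaceGrowth

section

/-! ### Linear combinations of square integrable functions -/

section LinearCombination

variable {α ι : Type*} [MeasurableSpace α] {μ : Measure α}

/-! Every finite partial sum of the series is a centred Gaussian field, so each moment of an
increment is a fixed multiple of its L² norm (`eLpNorm_eq_gaussNorm_mul`). By independence and the
Wiener isometry, the square of that L² norm is at most a sum over modes of squared L²(ds) norms of
kernel increments (`eLpNorm_sum_wienerPair_le`).

For one mode the kernel has norm at most 1/μ_k. Interpolating with min(1, x) ≤ x^θ buys Hölder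
exponent δ in time and 4δ in space, both at the price μ_k^(2δ). Increments between dyadic neighbours
of generation n are therefore at most a constant times μ_k^(2δ-1) 2^(-δn), and squaring produces
exactly the weights a_k² μ_k^(4δ-2) (`eLpNorm_increment_le`). Chaining along dyadic grids, started
at the origin where the field vanishes, turns this into a bound for the m-th moment of the supremum
when m > 12/δ (`eLpNorm_partialField_le`).

In dimension two the weights are summable for bounded a when δ < 1/4. The bound on finite sums then
makes the series summable in the Banach space L^m(Ω; C), whose elements already have continuous
sample functions. A Fatou argument carries the moment bounds to the limit with the same constant
(`eLpNorm_limit_le`).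

To have terms with values in C, the Wiener integrals, chosen separately for each t, are replaced by
a formula that is continuous in t, obtained by integrating by parts along the Brownian path
(`isWienerIntegral_ouPath`, `convMode_ae_eq`). -/

lemma eLpNorm_two_eq_ofReal_sqrt {f : α → ℝ} (hf : MemLp f 2 μ) :
    eLpNorm f 2 μ = ENNReal.ofReal (√(∫ x, f x ^ 2 ∂μ)) := by
  rw [hf.eLpNorm_eq_integral_rpow_norm (by norm_num) (by norm_num), Real.sqrt_eq_rpow]
  simp

lemma memLp_linearCombination {f : ι → α → ℝ} {p : ℝ≥0∞} (hf : ∀ i, MemLp (f i) p μ)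
    (c : ι →₀ ℝ) : MemLp (Finsupp.linearCombination ℝ f c) p μ := by
  rw [Finsupp.linearCombination_apply, Finsupp.sum]
  exact memLp_finsetSum' _ fun i _ => (hf i).const_smul _

lemma integral_linearCombination_sq {f : ι → α → ℝ} (hf : ∀ i, MemLp (f i) 2 μ) (c : ι →₀ ℝ) :
    ∫ x, (Finsupp.linearCombination ℝ f c x) ^ 2 ∂μ =
      ∑ i ∈ c.support, ∑ j ∈ c.support, c i * c j * ∫ x, f i x * f j x ∂μ := by
  have key : ∀ i j, Integrable (fun x => c i * c j * (f i x * f j x)) μ := fun i j =>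
    ((hf i).integrable_mul (hf j)).const_mul _
  have : ∀ x, (Finsupp.linearCombination ℝ f c x) ^ 2 =
      ∑ i ∈ c.support, ∑ j ∈ c.support, c i * c j * (f i x * f j x) := by
    intro x
    rw [Finsupp.linearCombination_apply, Finsupp.sum, Finset.sum_apply, sq, Finset.sum_mul_sum]
    refine Finset.sum_congr rfl fun i _ => Finset.sum_congr rfl fun j _ => ?_
    simp only [Pi.smul_apply, smul_eq_mul]
    ring
  simp_rw [this]
  rw [integral_finsetSum _ fun i _ => integrable_finsetSum _ fun j _ => key i j]
  refine Finset.sum_congr rfl fun i _ => ?_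
  rw [integral_finsetSum _ fun j _ => key i j]
  exact Finset.sum_congr rfl fun j _ => integral_const_mul _ _

/-- The norm of a linear combination depends only on its coefficients and the Gram matrix. -/
lemma eLpNorm_linearCombination_eq {β : Type*} [MeasurableSpace β] {ν : Measure β}
    {f : ι → α → ℝ} {g : ι → β → ℝ} (hf : ∀ i, MemLp (f i) 2 μ) (hg : ∀ i, MemLp (g i) 2 ν)
    (h : ∀ i j, ∫ x, f i x * f j x ∂μ = ∫ x, g i x * g j x ∂ν) (c : ι →₀ ℝ) :
    eLpNorm (Finsupp.linearCombination ℝ f c) 2 μ =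
      eLpNorm (Finsupp.linearCombination ℝ g c) 2 ν := by
  rw [eLpNorm_two_eq_ofReal_sqrt (memLp_linearCombination hf c),
    eLpNorm_two_eq_ofReal_sqrt (memLp_linearCombination hg c),
    integral_linearCombination_sq hf, integral_linearCombination_sq hg]
  simp_rw [h]

lemma tendsto_eLpNorm_of_tendsto_sub {E : Type*} [NormedAddCommGroup E] {l : Filter ι} {p : ℝ≥0∞}
    (hp : 1 ≤ p) {f : ι → α → E} {g : α → E} (hf : ∀ i, MemLp (f i) p μ) (hg : MemLp g p μ)
    (h : Tendsto (fun i => eLpNorm (f i - g) p μ) l (𝓝 0)) :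
    Tendsto (fun i => eLpNorm (f i) p μ) l (𝓝 (eLpNorm g p μ)) := by
  have : Fact (1 ≤ p) := ⟨hp⟩
  have := (Lp.tendsto_Lp_iff_tendsto_eLpNorm'' f hf g hg).2 h
  simpa only [Lp.enorm_toLp] using this.enorm

end LinearCombination

/-! ### The isometry of the Wiener integral -/

/-- The indicator function of `(0, τ]`. -/
def stepFn (τ : ℝ≥0) : ℝ → ℝ := (Set.Ioc 0 (τ : ℝ)).indicator fun _ => 1

lemma memLp_stepFn (τ : ℝ≥0) : MemLp (stepFn τ) 2 volume :=
  memLp_indicator_const 2 measurableSet_Ioc 1 (Or.inr (by simp))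

lemma integral_stepFn_mul (s t : ℝ≥0) :
    ∫ x, stepFn s x * stepFn t x = min (s : ℝ) t := by
  have : (fun x => stepFn s x * stepFn t x) =
      (Set.Ioc 0 (min (s : ℝ) t)).indicator fun _ => (1 : ℝ) := by
    ext x
    simp only [stepFn, Set.indicator_apply, Set.mem_Ioc, le_min_iff]
    split_ifs <;> first | (simp; done) | (exfalso; tauto)
  rw [this, integral_indicator_const _ measurableSet_Ioc]
  simp

variable {Ω : Type*} [MeasurableSpace Ω] {P : Measure Ω} {B : ℝ≥0 → Ω → ℝ}

lemma memLp_brownian (hB : IsPreBrownianReal B P) (t : ℝ≥0) {p : ℝ≥0∞} (hp : p ≠ ⊤) :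
    MemLp (B t) p P := (hB.isGaussianProcess.hasGaussianLaw_eval t).memLp hp

lemma integral_brownian_mul (hB : IsPreBrownianReal B P) (s t : ℝ≥0) :
    ∫ ω, B s ω * B t ω ∂P = min (s : ℝ) t := by
  have := hB.isGaussianProcess.isProbabilityMeasure
  have h := hB.covariance_eval s t
  rw [covariance_eq_sub (memLp_brownian hB s (by simp)) (memLp_brownian hB t (by simp)),
    hB.integral_eval, hB.integral_eval] at h
  simpa using h

/-- The Wiener isometry on step functions: both families have Gram matrix min(s, t). -/
lemma eLpNorm_combination_brownian (hB : IsPreBrownianReal B P) (c : ℝ≥0 →₀ ℝ) :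
    eLpNorm (Finsupp.linearCombination ℝ B c) 2 P =
      eLpNorm (Finsupp.linearCombination ℝ stepFn c) 2 volume :=
  eLpNorm_linearCombination_eq (fun t => memLp_brownian hB t (by simp)) memLp_stepFn
    (fun s t => by rw [integral_brownian_mul hB, integral_stepFn_mul]) c

/-- `U` is the Wiener integral over the half-line of the square integrable function `g`. -/
structure IsWienerPair (P : Measure Ω) (B : ℝ≥0 → Ω → ℝ) (g : ℝ → ℝ) (U : Ω → ℝ) : Prop where
  memLp_left : MemLp g 2 volume
  memLp_right : MemLp U 2 P
  approx : ∃ c : ℕ → (ℝ≥0 →₀ ℝ),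
    Tendsto (fun n => eLpNorm (Finsupp.linearCombination ℝ stepFn (c n) - g) 2 volume)
      atTop (𝓝 0) ∧
    Tendsto (fun n => eLpNorm (Finsupp.linearCombination ℝ B (c n) - U) 2 P) atTop (𝓝 0)

lemma tendsto_eLpNorm_zero_of_le {α ι : Type*} [MeasurableSpace α] {μ : Measure α} {l : Filter ι}
    {f f₁ f₂ : ι → α → ℝ} (h₁ : ∀ i, AEStronglyMeasurable (f₁ i) μ)
    (h₂ : ∀ i, AEStronglyMeasurable (f₂ i) μ) (a b : ℝ) (hf : ∀ i, f i = a • f₁ i + b • f₂ i)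
    (t₁ : Tendsto (fun i => eLpNorm (f₁ i) 2 μ) l (𝓝 0))
    (t₂ : Tendsto (fun i => eLpNorm (f₂ i) 2 μ) l (𝓝 0)) :
    Tendsto (fun i => eLpNorm (f i) 2 μ) l (𝓝 0) := by
  have t : Tendsto (fun i => ‖a‖ₑ * eLpNorm (f₁ i) 2 μ + ‖b‖ₑ * eLpNorm (f₂ i) 2 μ) l (𝓝 0) := by
    simpa using (ENNReal.Tendsto.const_mul t₁ (Or.inr (by simp))).add
      (ENNReal.Tendsto.const_mul t₂ (Or.inr (by simp)))
  refine tendsto_of_tendsto_of_tendsto_of_le_of_le tendsto_const_nhds t (fun _ => zero_le) ?_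
  intro i
  simp only
  rw [hf i]
  refine (eLpNorm_add_le ((h₁ i).const_smul a) ((h₂ i).const_smul b) (by norm_num)).trans ?_
  rw [eLpNorm_const_smul, eLpNorm_const_smul]

lemma IsWienerPair.combination (hB : IsPreBrownianReal B P) {g₁ g₂ : ℝ → ℝ} {U₁ U₂ : Ω → ℝ}
    (h₁ : IsWienerPair P B g₁ U₁) (h₂ : IsWienerPair P B g₂ U₂) (a b : ℝ) :
    IsWienerPair P B (a • g₁ + b • g₂) (a • U₁ + b • U₂) := by
  obtain ⟨c₁, hc₁, hd₁⟩ := h₁.approx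
  obtain ⟨c₂, hc₂, hd₂⟩ := h₂.approx
  have mJ := fun c => memLp_linearCombination (μ := volume) memLp_stepFn c
  have mW := fun c => memLp_linearCombination (fun t => memLp_brownian hB t (p := 2) (by simp)) c
  refine ⟨(h₁.1.const_smul a).add (h₂.1.const_smul b),
    (h₁.2.const_smul a).add (h₂.2.const_smul b), fun n => a • c₁ n + b • c₂ n, ?_, ?_⟩
  · refine tendsto_eLpNorm_zero_of_le (fun n => ((mJ (c₁ n)).sub h₁.1).1)
      (fun n => ((mJ (c₂ n)).sub h₂.1).1) a b (fun n => ?_) hc₁ hc₂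
    rw [map_add, map_smul, map_smul, smul_sub, smul_sub]
    abel
  · refine tendsto_eLpNorm_zero_of_le (fun n => ((mW (c₁ n)).sub h₁.2).1)
      (fun n => ((mW (c₂ n)).sub h₂.2).1) a b (fun n => ?_) hd₁ hd₂
    rw [map_add, map_smul, map_smul, smul_sub, smul_sub]
    abel

lemma IsWienerPair.eLpNorm_eq (hB : IsPreBrownianReal B P) {g : ℝ → ℝ} {U : Ω → ℝ}
    (h : IsWienerPair P B g U) : eLpNorm U 2 P = eLpNorm g 2 volume := by
  obtain ⟨c, hc, hd⟩ := h.approx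
  refine tendsto_nhds_unique (tendsto_eLpNorm_of_tendsto_sub (by norm_num)
    (fun n => memLp_linearCombination (fun t => memLp_brownian hB t (by simp)) (c n)) h.2 hd) ?_
  simp_rw [eLpNorm_combination_brownian hB]
  exact tendsto_eLpNorm_of_tendsto_sub (by norm_num)
    (fun n => memLp_linearCombination memLp_stepFn (c n)) h.1 hc

/-- The difference U - V is a Wiener integral of 0, so the isometry kills it. The approximating
sequences may be different. -/
lemma IsWienerPair.ae_eq (hB : IsPreBrownianReal B P) {g : ℝ → ℝ} {U V : Ω → ℝ}
    (hU : IsWienerPair P B g U) (hV : IsWienerPair P B g V) : U =ᵐ[P] V := by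
  have h := (hU.combination hB hV 1 (-1)).eLpNorm_eq hB
  have h0 : (1 : ℝ) • g + (-1 : ℝ) • g = 0 := by simp
  rw [h0, eLpNorm_zero, eLpNorm_eq_zero_iff
    ((hU.2.const_smul (1 : ℝ)).add (hV.2.const_smul (-1 : ℝ))).1 (by norm_num)] at h
  filter_upwards [h] with ω hω
  simp at hω
  linarith

/-! ### Step functions as linear combinations -/

/-- The coefficients of a step function with respect to the functions `1_(0,τ]`. -/
def StepFunction.coeff {t : ℝ≥0} (φ : StepFunction t) : ℝ≥0 →₀ ℝ :=
  ∑ i ∈ Finset.range φ.n,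
    (Finsupp.single (φ.τ (i + 1)) (φ.c i) - Finsupp.single (φ.τ i) (φ.c i))

lemma StepFunction.wiener_eq {Ω : Type*} {t : ℝ≥0} (φ : StepFunction t) (B : ℝ≥0 → Ω → ℝ) :
    φ.wiener B = Finsupp.linearCombination ℝ B φ.coeff := by
  ext ω
  simp only [StepFunction.wiener, StepFunction.coeff, map_sum, map_sub,
    Finsupp.linearCombination_single, Finset.sum_apply, Pi.sub_apply, Pi.smul_apply, smul_eq_mul,
    mul_sub]

lemma indicator_Ioc_eq_sub {a b : ℝ≥0} (h : a ≤ b) (c : ℝ) (s : ℝ) :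
    (Set.Ioc (a : ℝ) b).indicator (fun _ => c) s = c * stepFn b s - c * stepFn a s := by
  have h' : (a : ℝ) ≤ b := by exact_mod_cast h
  have ha : (0 : ℝ) ≤ a := a.2
  simp only [stepFn, Set.indicator_apply, Set.mem_Ioc]
  split_ifs with h1 h2 h3 h2 h3 h3 <;> first | (simp; done) | (exfalso; simp_all; linarith) | skip
  all_goals (exfalso; simp_all; try linarith)

lemma StepFunction.eval_eq {t : ℝ≥0} (φ : StepFunction t) :
    φ.eval = Finsupp.linearCombination ℝ stepFn φ.coeff := by
  ext s
  simp only [StepFunction.eval, StepFunction.coeff, map_sum, map_sub,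
    Finsupp.linearCombination_single, Finset.sum_apply, Pi.sub_apply, Pi.smul_apply, smul_eq_mul]
  exact Finset.sum_congr rfl fun i _ => indicator_Ioc_eq_sub (φ.mono i.le_succ) _ _

lemma StepFunction.eval_eq_zero {t : ℝ≥0} (φ : StepFunction t) {s : ℝ}
    (hs : s ∉ Set.Ioc 0 (t : ℝ)) : φ.eval s = 0 := by
  refine Finset.sum_eq_zero fun i _ => Set.indicator_of_notMem (fun h => hs ⟨?_, ?_⟩) _
  · exact lt_of_le_of_lt (φ.τ i).2 h.1
  · exact h.2.trans (by exact_mod_cast φ.le_t _)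

/-- Extension by zero puts the integrands for all end times t into one L² space, where increments in
t make sense. -/
lemma StepFunction.eLpNorm_eval_sub {t : ℝ≥0} (φ : StepFunction t) (f : ℝ → ℝ) :
    eLpNorm (fun s => φ.eval s - f s) 2 (volume.restrict (Set.Ioc 0 (t : ℝ))) =
      eLpNorm (Finsupp.linearCombination ℝ stepFn φ.coeff - (Set.Ioc 0 (t : ℝ)).indicator f)
        2 volume := by
  rw [← eLpNorm_indicator_eq_eLpNorm_restrict measurableSet_Ioc, ← φ.eval_eq]
  congr 1
  ext s
  by_cases hs : s ∈ Set.Ioc 0 (t : ℝ)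
  · simp [hs]
  · simp [hs, φ.eval_eq_zero hs]

lemma IsWienerIntegral.isWienerPair {t : ℝ≥0} {f : ℝ → ℝ} {I : Ω → ℝ}
    (hf : MemLp f 2 (volume.restrict (Set.Ioc 0 (t : ℝ)))) (h : IsWienerIntegral P B t f I) :
    IsWienerPair P B ((Set.Ioc 0 (t : ℝ)).indicator f) I := by
  obtain ⟨hI, φ, h₁, h₂⟩ := h
  refine ⟨(memLp_indicator_iff_restrict measurableSet_Ioc).2 hf, hI, fun n => (φ n).coeff, ?_, ?_⟩
  · simpa only [StepFunction.eLpNorm_eval_sub] using h₁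
  · simp_rw [← StepFunction.wiener_eq]
    exact h₂

/-- The elementary integrals of a convergent sequence of step functions converge in `L²(Ω)`. -/
lemma exists_isWienerIntegral_of_tendsto (hB : IsPreBrownianReal B P) {t : ℝ≥0} {f : ℝ → ℝ}
    (hf : MemLp f 2 (volume.restrict (Set.Ioc 0 (t : ℝ)))) (φ : ℕ → StepFunction t)
    (hφ : Tendsto (fun n => eLpNorm (fun s => (φ n).eval s - f s) 2
      (volume.restrict (Set.Ioc 0 (t : ℝ)))) atTop (𝓝 0)) :
    ∃ I : Ω → ℝ, MemLp I 2 P ∧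
      Tendsto (fun n => eLpNorm ((φ n).wiener B - I) 2 P) atTop (𝓝 0) := by
  have mJ := fun c => memLp_linearCombination (μ := volume) memLp_stepFn c
  have mW := fun c => memLp_linearCombination (fun t => memLp_brownian hB t (p := 2) (by simp)) c
  simp_rw [StepFunction.eLpNorm_eval_sub] at hφ
  have hJ := ((Lp.tendsto_Lp_iff_tendsto_eLpNorm'' _ (fun n => mJ (φ n).coeff) _
    ((memLp_indicator_iff_restrict measurableSet_Ioc).2 hf)).2 hφ).cauchySeq
  -- By the isometry the elementary integrals have the same mutual distances as the step functions.
  have hW : CauchySeq fun n => (mW (φ n).coeff).toLp := by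
    rw [cauchySeq_iff_tendsto_dist_atTop_0] at hJ ⊢
    refine hJ.congr fun n => ?_
    rw [dist_edist, dist_edist, Lp.edist_toLp_toLp, Lp.edist_toLp_toLp, ← map_sub, ← map_sub,
      eLpNorm_combination_brownian hB]
  obtain ⟨I, hI⟩ := cauchySeq_tendsto_of_complete hW
  refine ⟨I, Lp.memLp I, ?_⟩
  simp_rw [StepFunction.wiener_eq]
  rw [← Lp.tendsto_Lp_iff_tendsto_eLpNorm'' _ (fun n => mW (φ n).coeff) _ (Lp.memLp I)]
  simpa using hI

end

section

/-! ### Moments of Gaussian sums -/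

/-- The `L^p` norm of a standard Gaussian variable. -/
def gaussNorm (p : ℝ≥0∞) : ℝ≥0∞ := eLpNorm id p (gaussianReal 0 1)

lemma gaussNorm_ne_top {p : ℝ≥0∞} (hp : p ≠ ⊤) : gaussNorm p ≠ ⊤ :=
  (memLp_id_gaussianReal' p hp).2.ne

variable {Ω : Type*} [MeasurableSpace Ω] {P : Measure Ω}

lemma eLpNorm_two_eq_variance [IsProbabilityMeasure P] {U : Ω → ℝ} (hU : MemLp U 2 P)
    (h0 : P[U] = 0) : eLpNorm U 2 P = ENNReal.ofReal (√(Var[U; P])) := by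
  rw [eLpNorm_two_eq_ofReal_sqrt hU, variance_of_integral_eq_zero hU.1.aemeasurable h0]

/-- A centred Gaussian variable has the law of its standard deviation times a standard one, so
scaling gives every L^p norm. -/
lemma eLpNorm_eq_gaussNorm_mul [IsProbabilityMeasure P] {U : Ω → ℝ} (hU : HasGaussianLaw U P)
    (h0 : P[U] = 0) (p : ℝ≥0∞) : eLpNorm U p P = gaussNorm p * eLpNorm U 2 P := by
  have hmap := hU.map_eq_gaussianReal
  set v := Var[U; P].toNNReal with hv
  have hg : gaussianReal 0 v = (gaussianReal 0 1).map (fun x => √v * x) := by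
    have := gaussianReal_map_const_mul (μ := 0) (v := 1) (√(v : ℝ))
    rw [this]
    congr 1
    · simp
    · ext; simp
  have h1 : eLpNorm U p P = eLpNorm id p (P.map U) := by
    rw [eLpNorm_map_measure (by fun_prop) hU.aemeasurable]; rfl
  rw [h1, hmap, h0, hg, eLpNorm_map_measure (by fun_prop) (by fun_prop)]
  have h2 : (id ∘ fun x : ℝ => √v * x) = (√v) • (id : ℝ → ℝ) := by ext; simp
  rw [h2, eLpNorm_const_smul, eLpNorm_two_eq_variance hU.memLp_two h0, mul_comm, gaussNorm]
  congr 1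
  rw [Real.enorm_of_nonneg (Real.sqrt_nonneg _), hv, Real.coe_toNNReal _ (variance_nonneg _ _)]

lemma hasGaussianLaw_combination {B : ℝ≥0 → Ω → ℝ} (hB : IsPreBrownianReal B P) (c : ℝ≥0 →₀ ℝ) :
    HasGaussianLaw (Finsupp.linearCombination ℝ B c) P := by
  rw [Finsupp.linearCombination_apply, Finsupp.sum]
  exact (hB.isGaussianProcess.smul c).hasGaussianLaw_sum (I := c.support)

lemma integral_combination {B : ℝ≥0 → Ω → ℝ} (hB : IsPreBrownianReal B P) (c : ℝ≥0 →₀ ℝ) :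
    P[Finsupp.linearCombination ℝ B c] = 0 := by
  have : Finsupp.linearCombination ℝ B c = fun ω => ∑ i ∈ c.support, c i * B i ω := by
    ext ω
    simp [Finsupp.linearCombination_apply, Finsupp.sum]
  rw [this, integral_finsetSum _ fun i _ => (hB.integrable_eval i).const_mul _]
  refine Finset.sum_eq_zero fun i _ => ?_
  rw [integral_const_mul, hB.integral_eval, mul_zero]

variable {ι : Type*} {β : ι → ℝ≥0 → Ω → ℝ}

lemma iIndepFun_combination (hind : iIndepFun (fun k ω (t : ℝ≥0) => β k t ω) P)
    (c : ι → ℝ≥0 →₀ ℝ) : iIndepFun (fun k => Finsupp.linearCombination ℝ (β k) (c k)) P := by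
  have hm : ∀ k, Measurable fun x : ℝ≥0 → ℝ => ∑ i ∈ (c k).support, c k i * x i := fun k => by
    fun_prop
  convert hind.comp _ hm using 2 with k
  ext ω
  simp [Finsupp.linearCombination_apply, Finsupp.sum]

/-- Independence makes the sum Gaussian and its variance additive; the isometry evaluates each
variance. -/
lemma eLpNorm_sum_combination [IsProbabilityMeasure P] (hB : ∀ k, IsPreBrownianReal (β k) P)
    (hind : iIndepFun (fun k ω (t : ℝ≥0) => β k t ω) P) (F : Finset ι) (c : ι → ℝ≥0 →₀ ℝ)
    (p : ℝ≥0∞) :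
    eLpNorm (∑ k ∈ F, Finsupp.linearCombination ℝ (β k) (c k)) p P = gaussNorm p *
      (∑ k ∈ F, eLpNorm (Finsupp.linearCombination ℝ stepFn (c k)) 2 volume ^ 2) ^ (1 / 2 : ℝ) := by
  have hi := iIndepFun_combination hind c
  have hL : ∀ k, MemLp (Finsupp.linearCombination ℝ (β k) (c k)) 2 P := fun k =>
    (hasGaussianLaw_combination (hB k) (c k)).memLp_two
  have h0 : P[∑ k ∈ F, Finsupp.linearCombination ℝ (β k) (c k)] = 0 := by
    simp_rw [Finset.sum_apply]
    rw [integral_finsetSum _ fun k _ => (hL k).integrable (by norm_num)]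
    exact Finset.sum_eq_zero fun k _ => integral_combination (hB k) _
  have hG : HasGaussianLaw (∑ k ∈ F, Finsupp.linearCombination ℝ (β k) (c k)) P := by
    rw [← Finset.sum_coe_sort]
    exact iIndepFun.hasGaussianLaw_sum (fun k => hasGaussianLaw_combination (hB k) (c k))
      (hi.precomp Subtype.val_injective)
  rw [eLpNorm_eq_gaussNorm_mul hG h0, eLpNorm_two_eq_variance hG.memLp_two h0,
    IndepFun.variance_sum (fun k _ => hL k) fun i _ j _ hij => hi.indepFun hij,
    Real.sqrt_eq_rpow, ← ENNReal.ofReal_rpow_of_nonneg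
      (Finset.sum_nonneg fun k _ => variance_nonneg _ _) (by norm_num),
    ENNReal.ofReal_sum_of_nonneg fun k _ => variance_nonneg _ _]
  congr 3
  ext k
  rw [← eLpNorm_combination_brownian (hB k),
    eLpNorm_two_eq_variance (hL k) (integral_combination (hB k) _),
    ← ENNReal.ofReal_pow (Real.sqrt_nonneg _), Real.sq_sqrt (variance_nonneg _ _)]

/-- All moments of a finite sum of Wiener integrals with respect to independent Brownian motions
are controlled by the sum of the squared norms of the integrands. -/
lemma eLpNorm_sum_wienerPair_le [IsProbabilityMeasure P] (hB : ∀ k, IsPreBrownianReal (β k) P)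
    (hind : iIndepFun (fun k ω (t : ℝ≥0) => β k t ω) P) (F : Finset ι) {g : ι → ℝ → ℝ}
    {U : ι → Ω → ℝ} (h : ∀ k, IsWienerPair P (β k) (g k) (U k)) {p : ℝ≥0∞} (hp : p ≠ ⊤) :
    eLpNorm (∑ k ∈ F, U k) p P ≤
      gaussNorm p * (∑ k ∈ F, eLpNorm (g k) 2 volume ^ 2) ^ (1 / 2 : ℝ) := by
  choose c hc hd using fun k => (h k).approx
  have mW := fun k c => memLp_linearCombination (fun t => memLp_brownian (hB k) t (p := 2)
    (by simp)) c
  set V : ℕ → Ω → ℝ := fun n => ∑ k ∈ F, Finsupp.linearCombination ℝ (β k) (c k n) with hV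
  have hVm : ∀ n, AEStronglyMeasurable (V n) P := fun n =>
    (memLp_finsetSum' _ fun k _ => mW k (c k n)).1
  have hconv : Tendsto (fun n => eLpNorm (V n - ∑ k ∈ F, U k) 2 P) atTop (𝓝 0) := by
    have hz : Tendsto (fun n => ∑ k ∈ F,
        eLpNorm (Finsupp.linearCombination ℝ (β k) (c k n) - U k) 2 P) atTop (𝓝 0) := by
      simpa using tendsto_finsetSum F fun k _ => hd k
    refine tendsto_of_tendsto_of_tendsto_of_le_of_le tendsto_const_nhds hz (fun _ => zero_le) ?_
    intro n
    simp only [hV]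
    rw [← Finset.sum_sub_distrib]
    exact eLpNorm_sum_le (fun k _ => ((mW k (c k n)).sub (h k).2).1) (by norm_num)
  -- Convergence is known only in L². An almost surely convergent subsequence and Fatou still bound
  -- the L^p norm for every finite p.
  have hmeas := tendstoInMeasure_of_tendsto_eLpNorm (by norm_num) hVm
    (memLp_finsetSum' _ fun k _ => (h k).2).1 hconv
  obtain ⟨ns, hns, hae⟩ := hmeas.exists_seq_tendsto_ae'
  refine (Lp.eLpNorm_lim_le_liminf_eLpNorm (fun n => hVm (ns n)) _ hae).trans (le_of_eq ?_)
  refine Tendsto.liminf_eq ?_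
  simp only [hV]
  simp_rw [eLpNorm_sum_combination hB hind]
  refine ENNReal.Tendsto.const_mul ?_ (Or.inr (gaussNorm_ne_top hp))
  refine (ENNReal.continuous_rpow_const.tendsto _).comp ?_
  refine tendsto_finsetSum F fun k _ => ?_
  refine (ENNReal.continuous_pow 2).tendsto _ |>.comp ?_
  exact (tendsto_eLpNorm_of_tendsto_sub (by norm_num)
    (fun n => memLp_linearCombination memLp_stepFn (c k n)) (h k).1 (hc k)).comp hns

end

section

/-! ### The Ornstein-Uhlenbeck process -/

/-- The kernel `s ↦ exp(-(t-s)r)`. -/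
def ouKernel (r t s : ℝ) : ℝ := Real.exp (-(t - s) * r)

lemma continuous_ouKernel (r t : ℝ) : Continuous (ouKernel r t) := by
  unfold ouKernel; fun_prop

lemma ouKernel_nonneg (r t s : ℝ) : 0 ≤ ouKernel r t s := (Real.exp_pos _).le

lemma ouKernel_le_one {r t s : ℝ} (hr : 0 ≤ r) (hs : s ≤ t) : ouKernel r t s ≤ 1 :=
  Real.exp_le_one_iff.2 (by nlinarith)

lemma abs_ouKernel_sub_le {r t a s : ℝ} (hr : 0 ≤ r) (has : a ≤ s) (hst : s ≤ t) :
    |ouKernel r t a - ouKernel r t s| ≤ r * (s - a) := by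
  have h1 : ouKernel r t a = ouKernel r t s * Real.exp (-(s - a) * r) := by
    rw [ouKernel, ouKernel, ← Real.exp_add]; ring_nf
  have h2 := Real.add_one_le_exp (-(s - a) * r)
  have h3 : Real.exp (-(s - a) * r) ≤ 1 := Real.exp_le_one_iff.2 (by nlinarith)
  have h4 := ouKernel_le_one hr hst
  have h5 := ouKernel_nonneg r t s
  rw [h1, abs_le]
  constructor <;> nlinarith

lemma hasDerivAt_ouKernel (r t s : ℝ) : HasDerivAt (ouKernel r t) (r * ouKernel r t s) s := by
  have h : HasDerivAt (fun s : ℝ => -(t - s) * r) r s := by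
    simpa using (((hasDerivAt_id s).const_sub t).neg.mul_const r)
  have := h.exp
  rw [mul_comm] at this
  exact this

lemma memLp_ouKernel {r : ℝ} (hr : 0 ≤ r) (t : ℝ) :
    MemLp (ouKernel r t) 2 (volume.restrict (Set.Ioc 0 t)) := by
  refine MemLp.of_bound (continuous_ouKernel r t).aestronglyMeasurable 1 ?_
  filter_upwards [ae_restrict_mem measurableSet_Ioc] with s hs
  rw [Real.norm_of_nonneg (ouKernel_nonneg _ _ _)]
  exact ouKernel_le_one hr hs.2

/-- The nodes of the uniform partition of `[0,t]` into `n+1` intervals. -/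
def node (t : ℝ≥0) (n i : ℕ) : ℝ≥0 := t * (min i (n + 1) : ℕ) / (n + 1 : ℕ)

lemma node_zero (t : ℝ≥0) (n : ℕ) : node t n 0 = 0 := by simp [node]

lemma node_last (t : ℝ≥0) (n : ℕ) : node t n (n + 1) = t := by
  have : ((n + 1 : ℕ) : ℝ≥0) ≠ 0 := by positivity
  rw [node, min_self, mul_div_cancel_right₀ _ this]

lemma node_mono (t : ℝ≥0) (n : ℕ) : Monotone (node t n) := by
  intro i j hij
  unfold node
  gcongr

/-- The cap `min i (n + 1)` makes this true beyond the last node as well, since `StepFunction`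
constrains all indices. -/
lemma node_le (t : ℝ≥0) (n i : ℕ) : node t n i ≤ t := by
  refine (div_le_iff₀ (by positivity)).2 (mul_le_mul_right ?_ t)
  exact_mod_cast min_le_right _ _

lemma node_succ_le (t : ℝ≥0) (n i : ℕ) :
    (node t n (i + 1) : ℝ) ≤ node t n i + t / (n + 1 : ℕ) := by
  have h : ((min (i + 1) (n + 1) : ℕ) : ℝ) ≤ (min i (n + 1) : ℕ) + 1 := by
    exact_mod_cast (by omega : min (i + 1) (n + 1) ≤ min i (n + 1) + 1)
  have : ((node t n (i + 1) : ℝ≥0) : ℝ) = t * (min (i + 1) (n + 1) : ℕ) / (n + 1 : ℕ) := by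
    simp only [node, NNReal.coe_div, NNReal.coe_mul, NNReal.coe_natCast]
  rw [this]
  have : ((node t n i : ℝ≥0) : ℝ) = t * (min i (n + 1) : ℕ) / (n + 1 : ℕ) := by
    simp only [node, NNReal.coe_div, NNReal.coe_mul, NNReal.coe_natCast]
  rw [this, ← add_div]
  gcongr
  have := t.2
  nlinarith [mul_le_mul_of_nonneg_left h t.2]

/-- The step function interpolating `f` at the left end points of the uniform partition. -/
def uniformStep (t : ℝ≥0) (f : ℝ → ℝ) (n : ℕ) : StepFunction t where
  n := n + 1
  τ := node t n
  mono := node_mono t n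
  le_t := node_le t n
  c i := f (node t n i)

lemma sum_indicator_node (t : ℝ≥0) (n : ℕ) {s : ℝ} (hs : s ∈ Set.Ioc 0 (t : ℝ)) :
    ∑ i ∈ Finset.range (n + 1),
      (Set.Ioc (node t n i : ℝ) (node t n (i + 1))).indicator (fun _ => (1 : ℝ)) s = 1 := by
  simp_rw [indicator_Ioc_eq_sub (node_mono t n (Nat.le_succ _)), one_mul]
  rw [Finset.sum_range_sub (fun i => stepFn (node t n i) s), node_last, node_zero]
  simp [stepFn, hs.1, hs.2]

lemma abs_uniformStep_eval_sub_le {r : ℝ} (hr : 0 ≤ r) (t : ℝ≥0) (n : ℕ) {s : ℝ}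
    (hs : s ∈ Set.Ioc 0 (t : ℝ)) :
    |(uniformStep t (ouKernel r t) n).eval s - ouKernel r t s| ≤ r * (t / (n + 1 : ℕ)) := by
  -- Writing 1 as the sum of the cell indicators reduces the estimate to a single cell.
  have h1 : ouKernel r t s = ∑ i ∈ Finset.range (n + 1),
      (Set.Ioc (node t n i : ℝ) (node t n (i + 1))).indicator (fun _ => (1 : ℝ)) s *
        ouKernel r t s := by
    rw [← Finset.sum_mul, sum_indicator_node t n hs, one_mul]
  have h2 : r * (t / (n + 1 : ℕ)) = ∑ i ∈ Finset.range (n + 1),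
      (Set.Ioc (node t n i : ℝ) (node t n (i + 1))).indicator (fun _ => (1 : ℝ)) s *
        (r * (t / (n + 1 : ℕ))) := by
    rw [← Finset.sum_mul, sum_indicator_node t n hs, one_mul]
  rw [h1, h2]
  simp only [StepFunction.eval, uniformStep]
  rw [← Finset.sum_sub_distrib]
  refine (Finset.abs_sum_le_sum_abs _ _).trans (Finset.sum_le_sum fun i _ => ?_)
  by_cases h : s ∈ Set.Ioc (node t n i : ℝ) (node t n (i + 1))
  · simp only [Set.indicator_of_mem h, one_mul]
    refine (abs_ouKernel_sub_le hr h.1.le hs.2).trans ?_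
    gcongr
    have := node_succ_le t n i
    linarith [h.2]
  · simp [Set.indicator_of_notMem h]

lemma tendsto_mesh (t : ℝ) : Tendsto (fun n : ℕ => t / (n + 1 : ℕ)) atTop (𝓝 0) :=
  (tendsto_const_div_atTop_nhds_zero_nat t).comp (tendsto_add_atTop_nat 1)

lemma tendsto_uniformStep_eval {r : ℝ} (hr : 0 ≤ r) (t : ℝ≥0) :
    Tendsto (fun n => eLpNorm (fun s => (uniformStep t (ouKernel r t) n).eval s - ouKernel r t s)
      2 (volume.restrict (Set.Ioc 0 (t : ℝ)))) atTop (𝓝 0) := by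
  have hz : Tendsto (fun n : ℕ => (volume.restrict (Set.Ioc 0 (t : ℝ))) Set.univ ^
      (2 : ℝ≥0∞).toReal⁻¹ * ENNReal.ofReal (r * (t / (n + 1 : ℕ)))) atTop (𝓝 0) := by
    have h := (tendsto_mesh t).const_mul r
    rw [mul_zero] at h
    have h' := ENNReal.tendsto_ofReal h
    rw [ENNReal.ofReal_zero] at h'
    simpa using ENNReal.Tendsto.const_mul (a := (volume.restrict (Set.Ioc 0 (t : ℝ))) Set.univ ^
      (2 : ℝ≥0∞).toReal⁻¹) h' (Or.inr (by simp))
  refine tendsto_of_tendsto_of_tendsto_of_le_of_le tendsto_const_nhds hz (fun _ => zero_le) ?_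
  intro n
  refine eLpNorm_le_of_ae_bound ?_
  filter_upwards [ae_restrict_mem measurableSet_Ioc] with s hs
  exact abs_uniformStep_eval_sub_le hr t n hs

/-- The pathwise Ornstein-Uhlenbeck transform of `w`. -/
def ouPath (r : ℝ) (w : ℝ≥0 → ℝ) (t : ℝ) : ℝ :=
  w t.toNNReal - r * (Real.exp (-t * r) * ∫ s in 0..t, Real.exp (s * r) * w s.toNNReal)

lemma continuous_ouPath (r : ℝ) {w : ℝ≥0 → ℝ} (hw : Continuous w) : Continuous (ouPath r w) := by
  have h : Continuous fun s : ℝ => Real.exp (s * r) * w s.toNNReal :=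
    (by fun_prop : Continuous fun s : ℝ => Real.exp (s * r)).mul (hw.comp continuous_real_toNNReal)
  have h2 : Continuous fun t : ℝ => ∫ s in 0..t, Real.exp (s * r) * w s.toNNReal :=
    intervalIntegral.continuous_primitive (fun a b => h.intervalIntegrable a b) 0
  have h3 := hw.comp continuous_real_toNNReal
  unfold ouPath
  exact h3.sub (continuous_const.mul ((by fun_prop : Continuous fun t : ℝ =>
    Real.exp (-t * r)).mul h2))

lemma ouPath_zero (r : ℝ) (w : ℝ≥0 → ℝ) : ouPath r w 0 = w 0 := by simp [ouPath]

/-- For w(0) = 0 the right side is ∫ e^(-(t-s)r) dw(s) after integration by parts. The definition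
keeps e^(-tr) outside the integral so that continuity in t is that of a primitive. -/
lemma ouPath_eq (r : ℝ) (w : ℝ≥0 → ℝ) (t : ℝ≥0) :
    ouPath r w t = w t - ∫ s in 0..(t : ℝ), r * ouKernel r t s * w s.toNNReal := by
  rw [ouPath, Real.toNNReal_coe, ← intervalIntegral.integral_const_mul,
    ← intervalIntegral.integral_const_mul]
  congr 2
  ext s
  rw [ouKernel, ← mul_assoc, ← mul_assoc, mul_assoc r, ← Real.exp_add]
  ring_nf

/-- Abel summation, with kernel value 1 at s = t and w(0) = 0, moves the differences onto the
kernel, where they become integrals of its derivative. The remaining error is the integral of r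
e^(-(t-s)r) times an oscillation of w within one cell. -/
lemma abs_sum_sub_ouPath_le {r : ℝ} (hr : 0 ≤ r) {w : ℝ≥0 → ℝ} (hw : Continuous w) (h0 : w 0 = 0)
    (t : ℝ≥0) (n : ℕ) {η : ℝ}
    (hη : ∀ i ∈ Finset.range (n + 1), ∀ s ∈ Set.Ioc (node t n i : ℝ) (node t n (i + 1)),
      |w (node t n (i + 1)) - w s.toNNReal| ≤ η) :
    |(∑ i ∈ Finset.range (n + 1), ouKernel r t (node t n i) *
      (w (node t n (i + 1)) - w (node t n i))) - ouPath r w t| ≤ r * η * t := by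
  set f := ouKernel r t with hf
  have hcont : Continuous fun s : ℝ => r * f s * w s.toNNReal :=
    (continuous_const.mul (continuous_ouKernel r t)).mul (hw.comp continuous_real_toNNReal)
  have hcf : Continuous fun s => r * f s := continuous_const.mul (continuous_ouKernel r t)
  have htel : w t = ∑ i ∈ Finset.range (n + 1), (f (node t n (i + 1)) * w (node t n (i + 1)) -
      f (node t n i) * w (node t n i)) := by
    rw [Finset.sum_range_sub (fun i => f (node t n i) * w (node t n i)), node_last, node_zero, h0]
    simp [hf, ouKernel]
  have hint : ∫ s in 0..(t : ℝ), r * f s * w s.toNNReal = ∑ i ∈ Finset.range (n + 1),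
      ∫ s in (node t n i : ℝ)..(node t n (i + 1)), r * f s * w s.toNNReal := by
    rw [intervalIntegral.sum_integral_adjacent_intervals
      (a := fun i => (node t n i : ℝ)) fun i _ => hcont.intervalIntegrable _ _,
      node_last, node_zero, NNReal.coe_zero]
  have hincr : ∀ i, (f (node t n (i + 1)) - f (node t n i)) * w (node t n (i + 1)) =
      ∫ s in (node t n i : ℝ)..(node t n (i + 1)), r * f s * w (node t n (i + 1)) := by
    intro i
    rw [intervalIntegral.integral_mul_const, intervalIntegral.integral_eq_sub_of_hasDerivAt
      (fun s _ => hasDerivAt_ouKernel r t s) (hcf.intervalIntegrable _ _)]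
  have hdiff : (∑ i ∈ Finset.range (n + 1), f (node t n i) *
      (w (node t n (i + 1)) - w (node t n i))) - ouPath r w t =
      ∑ i ∈ Finset.range (n + 1), ∫ s in (node t n i : ℝ)..(node t n (i + 1)),
        r * f s * (w s.toNNReal - w (node t n (i + 1))) := by
    rw [ouPath_eq, htel, hint, ← Finset.sum_sub_distrib, ← Finset.sum_sub_distrib]
    refine Finset.sum_congr rfl fun i _ => ?_
    simp_rw [mul_sub]
    rw [intervalIntegral.integral_sub (hcont.intervalIntegrable _ _)
      (Continuous.intervalIntegrable (u := fun s => r * f s * w (node t n (i + 1)))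
        (hcf.mul continuous_const) _ _), ← hincr]
    ring
  rw [hdiff]
  have hsum : r * η * t = ∑ i ∈ Finset.range (n + 1),
      r * η * ((node t n (i + 1) : ℝ) - node t n i) := by
    rw [← Finset.mul_sum, Finset.sum_range_sub (fun i => (node t n i : ℝ)), node_last, node_zero]
    simp
  rw [hsum]
  refine (Finset.abs_sum_le_sum_abs _ _).trans (Finset.sum_le_sum fun i hi => ?_)
  have hle : (node t n i : ℝ) ≤ node t n (i + 1) := by exact_mod_cast node_mono t n (Nat.le_succ i)
  rw [← abs_of_nonneg (sub_nonneg.2 hle), ← Real.norm_eq_abs]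
  refine intervalIntegral.norm_integral_le_of_norm_le_const fun s hs => ?_
  rw [Set.uIoc_of_le hle] at hs
  have hst : s ≤ t := hs.2.trans (by exact_mod_cast node_le t n _)
  rw [norm_mul, norm_mul, Real.norm_of_nonneg hr, Real.norm_of_nonneg (ouKernel_nonneg _ _ _),
    ← norm_neg (w s.toNNReal - _), neg_sub]
  have h1 := ouKernel_le_one hr hst
  have h2 := hη i hi s hs
  have : r * f s ≤ r := by nlinarith
  exact mul_le_mul this h2 (norm_nonneg _) hr

lemma tendsto_sum_ouPath {r : ℝ} (hr : 0 ≤ r) {w : ℝ≥0 → ℝ} (hw : Continuous w) (h0 : w 0 = 0)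
    (t : ℝ≥0) :
    Tendsto (fun n => ∑ i ∈ Finset.range (n + 1), ouKernel r t (node t n i) *
      (w (node t n (i + 1)) - w (node t n i))) atTop (𝓝 (ouPath r w t)) := by
  rw [Metric.tendsto_atTop]
  intro ε hε
  have huc : UniformContinuousOn w (Set.Icc 0 t) :=
    isCompact_Icc.uniformContinuousOn_of_continuous hw.continuousOn
  rw [Metric.uniformContinuousOn_iff] at huc
  -- The added 1 keeps the denominator positive and makes the final inequality strict.
  have hpos : 0 < r * t + 1 := by have := mul_nonneg hr t.2; positivity
  obtain ⟨δ, hδ, hd⟩ := huc (ε / (r * t + 1)) (by positivity)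
  obtain ⟨N, hN⟩ := (Metric.tendsto_atTop.1 (tendsto_mesh t)) δ hδ
  refine ⟨N, fun n hn => ?_⟩
  have hmesh := hN n hn
  rw [Real.dist_eq, sub_zero, abs_of_nonneg (by positivity)] at hmesh
  rw [Real.dist_eq]
  refine (abs_sum_sub_ouPath_le hr hw h0 t n (η := ε / (r * t + 1)) ?_).trans_lt ?_
  · intro i _ s hs
    have hs0 : 0 ≤ s := (node t n i).2.trans hs.1.le
    have hst : s ≤ node t n (i + 1) := hs.2
    have hs' : s.toNNReal ≤ t := by
      rw [Real.toNNReal_le_iff_le_coe]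
      exact hs.2.trans (by exact_mod_cast node_le t n _)
    refine (hd _ ⟨zero_le, node_le t n _⟩ _ ⟨zero_le, hs'⟩ ?_).le
    rw [NNReal.dist_eq, Real.coe_toNNReal _ hs0, abs_of_nonneg (by linarith)]
    have := node_succ_le t n i
    linarith [hs.1]
  · rw [mul_div_assoc', div_mul_eq_mul_div, div_lt_iff₀ hpos]
    nlinarith

variable {Ω : Type*} [MeasurableSpace Ω] {P : Measure Ω} {B : ℝ≥0 → Ω → ℝ}

/-- The Ornstein-Uhlenbeck transform of a Brownian path is the Wiener integral of `ouKernel`. -/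
lemma isWienerIntegral_ouPath (hB : IsBrownianReal B P) {r : ℝ} (hr : 0 ≤ r) (t : ℝ≥0) :
    IsWienerIntegral P B t (ouKernel r t) (fun ω => ouPath r (B · ω) t) := by
  obtain ⟨I, hI, hlim⟩ := exists_isWienerIntegral_of_tendsto hB.toIsPreBrownianReal
    (memLp_ouKernel hr t) _ (tendsto_uniformStep_eval hr t)
  have hmW : ∀ n, MemLp ((uniformStep t (ouKernel r t) n).wiener B) 2 P := fun n => by
    rw [StepFunction.wiener_eq]
    exact memLp_linearCombination (fun t => memLp_brownian hB.toIsPreBrownianReal t (by simp)) _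
  -- Along a subsequence the Riemann sums tend almost surely to I, while pathwise they tend to the
  -- transform; so the two agree.
  obtain ⟨ns, hns, hae⟩ := (tendstoInMeasure_of_tendsto_eLpNorm (by norm_num)
    (fun n => (hmW n).1) hI.1 hlim).exists_seq_tendsto_ae'
  have heq : I =ᵐ[P] fun ω => ouPath r (B · ω) t := by
    filter_upwards [hae, hB.cont, hB.eval_zero_ae_eq_zero] with ω h1 h2 h3
    exact tendsto_nhds_unique h1 ((tendsto_sum_ouPath hr h2 h3 t).comp hns)
  refine ⟨hI.ae_eq heq, uniformStep t (ouKernel r t), tendsto_uniformStep_eval hr t, ?_⟩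
  exact hlim.congr fun n => eLpNorm_congr_ae (EventuallyEq.rfl.sub heq)

end

section

/-! ### Norms of the kernels -/

/-- The kernel of the Ornstein-Uhlenbeck process at time `t`, extended by zero. -/
def ouInd (r t : ℝ) : ℝ → ℝ := (Set.Ioc 0 t).indicator (ouKernel r t)

lemma memLp_ouInd {r : ℝ} (hr : 0 ≤ r) (t : ℝ) : MemLp (ouInd r t) 2 volume :=
  (memLp_indicator_iff_restrict measurableSet_Ioc).2 (memLp_ouKernel hr t)

lemma integral_ouInd_mul {r s t : ℝ} (hr : 0 < r) (hs : 0 ≤ s) (hst : s ≤ t) :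
    ∫ x, ouInd r s x * ouInd r t x =
      (Real.exp (-(t - s) * r) - Real.exp (-(s + t) * r)) / (2 * r) := by
  have h1 : (fun x => ouInd r s x * ouInd r t x) =
      (Set.Ioc 0 s).indicator fun x => Real.exp (-(s + t - 2 * x) * r) := by
    ext x
    by_cases hx : x ∈ Set.Ioc 0 s
    · have hx' : x ∈ Set.Ioc 0 t := ⟨hx.1, hx.2.trans hst⟩
      simp only [ouInd, Set.indicator_of_mem hx, Set.indicator_of_mem hx', ouKernel]
      rw [← Real.exp_add]
      ring_nf
    · simp [ouInd, Set.indicator_of_notMem hx]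
  have hd : ∀ x ∈ Set.uIcc 0 s, HasDerivAt (fun x => Real.exp (-(s + t - 2 * x) * r) / (2 * r))
      (Real.exp (-(s + t - 2 * x) * r)) x := by
    intro x _
    have h : HasDerivAt (fun x : ℝ => -(s + t - 2 * x) * r) (2 * r) x := by
      simpa using ((((hasDerivAt_id x).const_mul 2).const_sub (s + t)).neg.mul_const r)
    have h2 := h.exp.div_const (2 * r)
    rwa [mul_div_cancel_right₀ _ (by positivity)] at h2
  rw [h1, integral_indicator measurableSet_Ioc, ← intervalIntegral.integral_of_le hs,
    intervalIntegral.integral_eq_sub_of_hasDerivAt hd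
      ((by fun_prop : Continuous fun x : ℝ =>
        Real.exp (-(s + t - 2 * x) * r)).intervalIntegrable _ _), ← sub_div]
  ring_nf

/-- The interpolation that trades Hölder regularity for powers of the eigenvalue, in time and in
space. -/
lemma min_one_le_rpow {x θ : ℝ} (hx : 0 ≤ x) (h0 : 0 ≤ θ) (h1 : θ ≤ 1) : min 1 x ≤ x ^ θ := by
  rcases le_total 1 x with h | h
  · exact (min_le_left _ _).trans (Real.one_le_rpow h h0)
  · exact (min_le_right _ _).trans (Real.self_le_rpow_of_le_one hx h h1)

lemma integral_ouInd_sq_le {r t : ℝ} (hr : 0 < r) (ht : 0 ≤ t) :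
    ∫ x, ouInd r t x ^ 2 ≤ 1 / r := by
  simp_rw [sq]
  rw [integral_ouInd_mul hr ht le_rfl, div_le_div_iff₀ (by positivity) hr]
  have h1 : Real.exp (-(t - t) * r) = 1 := by simp
  have := Real.exp_pos (-(t + t) * r)
  rw [h1]
  nlinarith

/-- The stationary process would give (1 - e^(-(t-s)r))/r for s ≤ t. Starting from zero only
subtracts a square, and 1 - e^(-x) ≤ min(1, x) ≤ x^θ. -/
lemma integral_ouInd_sub_sq_le {r s t θ : ℝ} (hr : 0 < r) (hs : 0 ≤ s) (ht : 0 ≤ t) (h0 : 0 ≤ θ)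
    (h1 : θ ≤ 1) : ∫ x, (ouInd r t x - ouInd r s x) ^ 2 ≤ 1 / r * (r * |t - s|) ^ θ := by
  wlog hst : s ≤ t generalizing s t
  · have := this ht hs (le_of_not_ge hst)
    rw [abs_sub_comm] at this
    refine le_trans (le_of_eq ?_) this
    congr 1
    ext x
    ring
  have it : Integrable (fun x => ouInd r t x * ouInd r t x) volume :=
    (memLp_ouInd hr.le t).integrable_mul (memLp_ouInd hr.le t)
  have is : Integrable (fun x => ouInd r s x * ouInd r s x) volume :=
    (memLp_ouInd hr.le s).integrable_mul (memLp_ouInd hr.le s)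
  have ist : Integrable (fun x => 2 * (ouInd r s x * ouInd r t x)) volume :=
    ((memLp_ouInd hr.le s).integrable_mul (memLp_ouInd hr.le t)).const_mul 2
  have i2 : Integrable (fun x => ouInd r t x * ouInd r t x + ouInd r s x * ouInd r s x) volume :=
    it.add is
  have hexp : (fun x => (ouInd r t x - ouInd r s x) ^ 2) = fun x =>
      ouInd r t x * ouInd r t x + ouInd r s x * ouInd r s x - 2 * (ouInd r s x * ouInd r t x) := by
    ext x; ring
  rw [hexp, integral_sub i2 ist, integral_add it is, integral_const_mul,
    integral_ouInd_mul hr ht le_rfl, integral_ouInd_mul hr hs le_rfl, integral_ouInd_mul hr hs hst]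
  have hE : (Real.exp (-t * r) - Real.exp (-s * r)) ^ 2 = Real.exp (-(t + t) * r) +
      Real.exp (-(s + s) * r) - 2 * Real.exp (-(s + t) * r) := by
    have e1 : Real.exp (-(t + t) * r) = Real.exp (-t * r) * Real.exp (-t * r) := by
      rw [← Real.exp_add]; ring_nf
    have e2 : Real.exp (-(s + s) * r) = Real.exp (-s * r) * Real.exp (-s * r) := by
      rw [← Real.exp_add]; ring_nf
    have e3 : Real.exp (-(s + t) * r) = Real.exp (-s * r) * Real.exp (-t * r) := by
      rw [← Real.exp_add]; ring_nf
    rw [e1, e2, e3]; ring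
  have h2 : 1 - Real.exp (-(t - s) * r) ≤ min 1 (r * |t - s|) := by
    rw [abs_of_nonneg (sub_nonneg.2 hst)]
    refine le_min (by linarith [Real.exp_pos (-(t - s) * r)]) ?_
    have := Real.add_one_le_exp (-(t - s) * r)
    linarith
  have h3 := h2.trans (min_one_le_rpow (by positivity) h0 h1)
  have et : Real.exp (-(t - t) * r) = 1 := by simp
  have es : Real.exp (-(s - s) * r) = 1 := by simp
  rw [et, es]
  calc _ = 1 / r * ((1 - Real.exp (-(t - s) * r)) -
        (Real.exp (-t * r) - Real.exp (-s * r)) ^ 2 / 2) := by rw [hE]; field_simp; ring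
    _ ≤ 1 / r * (r * |t - s|) ^ θ := by
        gcongr
        nlinarith [sq_nonneg (Real.exp (-t * r) - Real.exp (-s * r))]

lemma eLpNorm_ouInd_le {m t : ℝ} (hm : 0 < m) (ht : 0 ≤ t) :
    eLpNorm (ouInd (m ^ 2) t) 2 volume ≤ ENNReal.ofReal m⁻¹ := by
  rw [eLpNorm_two_eq_ofReal_sqrt (memLp_ouInd (by positivity) t)]
  refine ENNReal.ofReal_le_ofReal (Real.sqrt_le_iff.2 ⟨by positivity, ?_⟩)
  refine (integral_ouInd_sq_le (by positivity) ht).trans (le_of_eq ?_)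
  rw [inv_pow, one_div]

lemma eLpNorm_ouInd_sub_le {m s t δ : ℝ} (hm : 0 < m) (hs : 0 ≤ s) (ht : 0 ≤ t) (h0 : 0 ≤ δ)
    (h1 : 2 * δ ≤ 1) : eLpNorm (ouInd (m ^ 2) t - ouInd (m ^ 2) s) 2 volume ≤
      ENNReal.ofReal (m⁻¹ * (m ^ (2 * δ) * |t - s| ^ δ)) := by
  rw [eLpNorm_two_eq_ofReal_sqrt
    ((memLp_ouInd (by positivity) t).sub (memLp_ouInd (by positivity) s))]
  refine ENNReal.ofReal_le_ofReal (Real.sqrt_le_iff.2 ⟨by positivity, ?_⟩)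
  -- The square root halves θ = 2δ, and r = m² then turns r^δ into m^(2δ).
  refine (integral_ouInd_sub_sq_le (by positivity) hs ht (θ := 2 * δ) (by positivity) h1).trans
    (le_of_eq ?_)
  rw [Real.mul_rpow (by positivity) (by positivity), mul_pow, mul_pow, inv_pow, one_div]
  congr 2
  · rw [← Real.rpow_natCast, ← Real.rpow_natCast, ← Real.rpow_mul hm.le, ← Real.rpow_mul hm.le]
    congr 1
    push_cast; ring
  · rw [← Real.rpow_natCast, ← Real.rpow_mul (abs_nonneg _)]
    congr 1
    push_cast; ring

/-! ### Eigenvalues and eigenfunctions -/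

lemma Mode.abs_pos (k : Mode) : 0 < k.abs := by
  refine Real.sqrt_pos.2 ?_
  have h : k.1.1 ≠ 0 ∨ k.1.2 ≠ 0 := by
    by_contra! h
    exact k.2 (Prod.ext h.1 h.2)
  rcases h with h | h
  · have : (k.1.1 : ℝ) ≠ 0 := by exact_mod_cast h
    positivity
  · have : (k.1.2 : ℝ) ≠ 0 := by exact_mod_cast h
    positivity

lemma Mode.abs_fst_le (k : Mode) : |(k.1.1 : ℝ)| ≤ k.abs :=
  Real.abs_le_sqrt (by nlinarith [sq_nonneg (k.1.2 : ℝ)])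

lemma Mode.abs_snd_le (k : Mode) : |(k.1.2 : ℝ)| ≤ k.abs :=
  Real.abs_le_sqrt (by nlinarith [sq_nonneg (k.1.1 : ℝ)])

lemma eigenvalue_pos {L : ℝ} (hL : 0 < L) (k : Mode) : 0 < eigenvalue L k := by
  have := k.abs_pos
  unfold eigenvalue
  positivity

/-- The summand is a constant times |k|^(-(4-8δ)), and 4 - 8δ exceeds the dimension 2 exactly when δ
< 1/4. The sup norm is at most |k|, so the lattice sum for that norm dominates. -/
lemma summable_eigenvalue_rpow {L : ℝ} (hL : 0 < L) {δ : ℝ} (hδ : δ < 1 / 4) :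
    Summable fun k : Mode => eigenvalue L k ^ (4 * δ - 2) := by
  have h := EisensteinSeries.summable_one_div_norm_rpow (k := 4 - 8 * δ) (by linarith)
  have hinj : Function.Injective fun k : Mode => ![k.1.1, k.1.2] := by
    intro k l hkl
    have h0 := congrFun hkl 0
    have h1 := congrFun hkl 1
    exact Subtype.ext (Prod.ext h0 h1)
  have h2 := (h.comp_injective hinj).mul_left ((2 * Real.pi / L) ^ (2 * (4 * δ - 2)))
  refine h2.of_nonneg_of_le (fun k => Real.rpow_nonneg (eigenvalue_pos hL k).le _) fun k => ?_
  have hn : ‖![k.1.1, k.1.2]‖ ≤ k.abs := by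
    refine (pi_norm_le_iff_of_nonneg k.abs_pos.le).2 fun i => ?_
    fin_cases i
    · simpa [Int.norm_eq_abs] using k.abs_fst_le
    · simpa [Int.norm_eq_abs] using k.abs_snd_le
  have hpos : 0 < ‖![k.1.1, k.1.2]‖ := by
    rw [norm_pos_iff]
    intro h0
    exact k.2 (Prod.ext (congrFun h0 0) (congrFun h0 1))
  have he : eigenvalue L k ^ (4 * δ - 2) =
      (2 * Real.pi / L) ^ (2 * (4 * δ - 2)) * k.abs ^ (-(4 - 8 * δ)) := by
    have hk := k.abs_pos
    have : eigenvalue L k = (2 * Real.pi / L * k.abs) ^ (2 : ℝ) := by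
      rw [Real.rpow_two, eigenvalue]; ring
    rw [this, ← Real.rpow_mul (by positivity), Real.mul_rpow (by positivity) hk.le]
    congr 2
    ring
  rw [he]
  exact mul_le_mul_of_nonneg_left (Real.rpow_le_rpow_of_nonpos hpos hn (by linarith))
    (by positivity)

lemma abs_trigBasis_le {L : ℝ} (hL : 0 < L) (m : ℤ) (z : ℝ) :
    |trigBasis L m z| ≤ √(2 / L) := by
  unfold trigBasis
  have hs := Real.sqrt_nonneg (2 / L)
  split_ifs
  · rw [abs_mul, abs_of_nonneg hs]
    exact mul_le_of_le_one_right hs (Real.abs_sin_le_one _)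
  · rw [abs_of_nonneg (by positivity), Real.sqrt_div (by norm_num)]
    gcongr
    exact Real.one_le_sqrt.2 (by norm_num)
  · rw [abs_mul, abs_of_nonneg hs]
    exact mul_le_of_le_one_right hs (Real.abs_cos_le_one _)

/-- Sine and cosine are bounded by 1 and 1-Lipschitz, which gives 2 min(1, x) with x the phase
bound. Here c will be |k|. -/
lemma abs_trigBasis_sub_le {L : ℝ} (hL : 0 < L) (m : ℤ) {c : ℝ} (hm : |(m : ℝ)| ≤ c) (z z' : ℝ)
    {θ : ℝ} (h0 : 0 ≤ θ) (h1 : θ ≤ 1) :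
    |trigBasis L m z - trigBasis L m z'| ≤
      √(2 / L) * (2 * ((2 * Real.pi * c / L) ^ θ * |z - z'| ^ θ)) := by
  have hc : 0 ≤ c := (abs_nonneg _).trans hm
  have hs := Real.sqrt_nonneg (2 / L)
  have hπ := Real.pi_pos
  have key : ∀ f : ℝ → ℝ, (∀ x, |f x| ≤ 1) → (∀ x y, |f x - f y| ≤ |x - y|) →
      |√(2 / L) * f (2 * Real.pi * m * z / L) - √(2 / L) * f (2 * Real.pi * m * z' / L)| ≤
      √(2 / L) * (2 * ((2 * Real.pi * c / L) ^ θ * |z - z'| ^ θ)) := by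
    intro f hf1 hf2
    rw [← mul_sub, abs_mul, abs_of_nonneg hs, ← Real.mul_rpow (by positivity) (abs_nonneg _)]
    refine mul_le_mul_of_nonneg_left ?_ hs
    have hb : |2 * Real.pi * m * z / L - 2 * Real.pi * m * z' / L| ≤
        2 * Real.pi * c / L * |z - z'| := by
      have : 2 * Real.pi * m * z / L - 2 * Real.pi * m * z' / L =
        2 * Real.pi / L * (m * (z - z')) := by ring
      rw [this, abs_mul, abs_mul, abs_of_nonneg (by positivity)]
      calc 2 * Real.pi / L * (|(m : ℝ)| * |z - z'|) ≤ 2 * Real.pi / L * (c * |z - z'|) := by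
            gcongr
        _ = _ := by ring
    refine le_trans ?_ (mul_le_mul_of_nonneg_left
      (min_one_le_rpow (x := 2 * Real.pi * c / L * |z - z'|) (by positivity) h0 h1) zero_le_two)
    rw [mul_min_of_nonneg _ _ zero_le_two]
    refine le_min ?_ ?_
    · refine (abs_sub _ _).trans ?_
      linarith [hf1 (2 * Real.pi * m * z / L), hf1 (2 * Real.pi * m * z' / L)]
    · refine (hf2 _ _).trans (hb.trans ?_)
      have : 0 ≤ 2 * Real.pi * c / L * |z - z'| := by positivity
      linarith
  have lip : ∀ {f : ℝ → ℝ}, LipschitzWith 1 f → ∀ x y, |f x - f y| ≤ |x - y| := by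
    intro f hf x y
    simpa [Real.dist_eq] using hf.dist_le_mul x y
  unfold trigBasis
  split_ifs
  · exact key Real.sin Real.abs_sin_le_one (lip Real.lipschitzWith_sin)
  · rw [sub_self, abs_zero]; positivity
  · exact key Real.cos Real.abs_cos_le_one (lip Real.lipschitzWith_cos)

lemma continuous_trigBasis (L : ℝ) (m : ℤ) : Continuous (trigBasis L m) := by
  unfold trigBasis
  split_ifs <;> fun_prop

lemma abs_eigenfunction_le {L : ℝ} (hL : 0 < L) (k : Mode) (x₁ x₂ : ℝ) :
    |eigenfunction L k x₁ x₂| ≤ 2 / L := by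
  rw [eigenfunction, abs_mul, ← Real.mul_self_sqrt (by positivity : 0 ≤ 2 / L)]
  exact mul_le_mul (abs_trigBasis_le hL _ _) (abs_trigBasis_le hL _ _) (abs_nonneg _)
    (Real.sqrt_nonneg _)

/-- The frequency 2π|k|/L is the square root of μ_k, so exponent 4δ in space costs μ_k^(2δ), the
same as exponent δ in time. -/
lemma abs_eigenfunction_sub_le {L : ℝ} (hL : 0 < L) (k : Mode) (x₁ x₂ y₁ y₂ : ℝ)
    {δ : ℝ} (h0 : 0 ≤ δ) (h1 : 4 * δ ≤ 1) :
    |eigenfunction L k x₁ x₂ - eigenfunction L k y₁ y₂| ≤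
      2 / L * (2 * (eigenvalue L k ^ (2 * δ) * (|x₁ - y₁| ^ (4 * δ) + |x₂ - y₂| ^ (4 * δ)))) := by
  have hk := k.abs_pos
  have hs := Real.sqrt_nonneg (2 / L)
  have hpow : eigenvalue L k ^ (2 * δ) = (2 * Real.pi * k.abs / L) ^ (4 * δ) := by
    rw [eigenvalue, ← Real.rpow_two, ← Real.rpow_mul (by have := Real.pi_pos; positivity)]
    congr 1
    ring
  rw [hpow]
  have e1 := abs_trigBasis_sub_le hL k.1.1 k.abs_fst_le x₁ y₁ (θ := 4 * δ) (by positivity) h1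
  have e2 := abs_trigBasis_sub_le hL k.1.2 k.abs_snd_le x₂ y₂ (θ := 4 * δ) (by positivity) h1
  have b1 := abs_trigBasis_le hL k.1.2 x₂
  have b2 := abs_trigBasis_le hL k.1.1 y₁
  have hdec : eigenfunction L k x₁ x₂ - eigenfunction L k y₁ y₂ =
      (trigBasis L k.1.1 x₁ - trigBasis L k.1.1 y₁) * trigBasis L k.1.2 x₂ +
      trigBasis L k.1.1 y₁ * (trigBasis L k.1.2 x₂ - trigBasis L k.1.2 y₂) := by
    unfold eigenfunction; ring
  rw [hdec]
  refine (abs_add_le _ _).trans ?_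
  rw [abs_mul, abs_mul]
  refine (add_le_add (mul_le_mul e1 b1 (abs_nonneg _) ((abs_nonneg _).trans e1))
    (mul_le_mul b2 e2 (abs_nonneg _) hs)).trans (le_of_eq ?_)
  conv_rhs => rw [← Real.mul_self_sqrt (by positivity : 0 ≤ 2 / L)]
  ring

end

section

/-! ### Chaining -/

section Chaining

variable {K : Type*}

lemma enorm_continuousMap_le [TopologicalSpace K] [CompactSpace K] (f : C(K, ℝ)) {c : ℝ≥0∞} (h : ∀ q, ‖f q‖ₑ ≤ c) : ‖f‖ₑ ≤ c := by
  induction c with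
  | top => exact le_top
  | coe c =>
    refine ENNReal.coe_le_coe.2 ?_
    refine (ContinuousMap.norm_le f c.2).2 fun q => ?_
    exact_mod_cast h q

lemma enorm_apply_le_tsum [TopologicalSpace K] (f : C(K, ℝ)) {q₀ q : K} (h₀ : f q₀ = 0) {π : ℕ → K → K}
    (hπ0 : π 0 q = q₀) (hπ : Tendsto (fun n => π n q) atTop (𝓝 q)) :
    ‖f q‖ₑ ≤ ∑' n, ‖f (π (n + 1) q) - f (π n q)‖ₑ := by
  refine le_of_tendsto ((f.continuous.tendsto q).comp hπ).enorm (Eventually.of_forall fun N => ?_)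
  refine le_trans ?_ (ENNReal.sum_le_tsum (Finset.range N))
  have : f (π N q) = ∑ n ∈ Finset.range N, (f (π (n + 1) q) - f (π n q)) := by
    rw [Finset.sum_range_sub (fun n => f (π n q)), hπ0, h₀, sub_zero]
  simp only [Function.comp_apply]
  rw [this]
  exact enorm_sum_le _ _

/-- The deterministic part of the chaining argument. -/
lemma enorm_rpow_le_tsum [TopologicalSpace K] [CompactSpace K] (f : C(K, ℝ)) {q₀ : K} (h₀ : f q₀ = 0) {π : ℕ → K → K}
    (hπ0 : ∀ q, π 0 q = q₀) (hπ : ∀ q, Tendsto (fun n => π n q) atTop (𝓝 q))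
    {D : ℕ → Finset (K × K)} (hD : ∀ n q, (π (n + 1) q, π n q) ∈ D n)
    {ρ : ℝ≥0∞} (hρ0 : ρ ≠ 0) (hρ : ρ ≠ ⊤) {m : ℝ} (hm : 0 < m) :
    ‖f‖ₑ ^ m ≤ ((1 - ρ)⁻¹) ^ m *
      ∑' n, ∑ d ∈ D n, (ρ⁻¹ ^ n) ^ m * ‖f d.1 - f d.2‖ₑ ^ m := by
  set G := ∑' n, ∑ d ∈ D n, (ρ⁻¹ ^ n) ^ m * ‖f d.1 - f d.2‖ₑ ^ m with hG
  have hG' : G = (G ^ (1 / m)) ^ m := by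
    rw [← ENNReal.rpow_mul, one_div, inv_mul_cancel₀ hm.ne', ENNReal.rpow_one]
  rw [hG', ← ENNReal.mul_rpow_of_nonneg _ _ hm.le]
  refine ENNReal.rpow_le_rpow ?_ hm.le
  refine enorm_continuousMap_le f fun q => ?_
  refine (enorm_apply_le_tsum f h₀ (hπ0 q) (hπ q)).trans ?_
  rw [← ENNReal.tsum_geometric, ← ENNReal.tsum_mul_right]
  refine ENNReal.tsum_le_tsum fun n => ?_
  -- Each link is one term of G, hence at most ρ^n G^(1/m); these bounds sum geometrically.
  have h1 : (ρ⁻¹ ^ n) ^ m * ‖f (π (n + 1) q) - f (π n q)‖ₑ ^ m ≤ G :=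
    (Finset.single_le_sum (f := fun d : K × K => (ρ⁻¹ ^ n) ^ m * ‖f d.1 - f d.2‖ₑ ^ m)
      (fun _ _ => zero_le) (hD n q)).trans
      (ENNReal.le_tsum (f := fun n => ∑ d ∈ D n, (ρ⁻¹ ^ n) ^ m * ‖f d.1 - f d.2‖ₑ ^ m) n)
  rw [← ENNReal.mul_rpow_of_nonneg _ _ hm.le] at h1
  have h2 := ENNReal.rpow_le_rpow h1 (by positivity : 0 ≤ 1 / m)
  rw [← ENNReal.rpow_mul, mul_one_div_cancel hm.ne', ENNReal.rpow_one] at h2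
  calc ‖f (π (n + 1) q) - f (π n q)‖ₑ
      = ρ ^ n * (ρ⁻¹ ^ n * ‖f (π (n + 1) q) - f (π n q)‖ₑ) := by
        rw [← mul_assoc, ← mul_pow, ENNReal.mul_inv_cancel hρ0 hρ, one_pow, one_mul]
    _ ≤ ρ ^ n * G ^ (1 / m) := by gcongr

variable {Ω : Type*} [MeasurableSpace Ω] {P : Measure Ω}

/-- The constant of the chaining inequality. -/
def chainConst (c N ρ r : ℝ≥0∞) (m : ℝ) : ℝ≥0∞ :=
  (1 - ρ)⁻¹ * (c * (1 - N * (ρ⁻¹ * r) ^ m)⁻¹) ^ (1 / m)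

/-- The maximum over the links of a level is bounded by the sum of their m-th powers. With weight
ρ^(-nm), level n contributes at most c A^m (N (r/ρ)^m)^n in expectation. Divergence is harmless in
`ℝ≥0∞`; finiteness is checked in `chainConst_ne_top`. -/
lemma eLpNorm_le_of_increments [TopologicalSpace K] [CompactSpace K] {X : Ω → C(K, ℝ)} (hX : ∀ q, AEStronglyMeasurable (X · q) P)
    {q₀ : K} (h₀ : ∀ᵐ ω ∂P, X ω q₀ = 0) {π : ℕ → K → K}
    (hπ0 : ∀ q, π 0 q = q₀) (hπ : ∀ q, Tendsto (fun n => π n q) atTop (𝓝 q))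
    {D : ℕ → Finset (K × K)} (hD : ∀ n q, (π (n + 1) q, π n q) ∈ D n) {c N : ℝ≥0∞}
    (hcard : ∀ n, ((D n).card : ℝ≥0∞) ≤ c * N ^ n)
    {ρ r A : ℝ≥0∞} (hρ0 : ρ ≠ 0) (hρ : ρ ≠ ⊤) {m : ℝ} (hm : 0 < m)
    (hinc : ∀ n, ∀ d ∈ D n,
      eLpNorm (fun ω => X ω d.1 - X ω d.2) (ENNReal.ofReal m) P ≤ A * r ^ n) :
    eLpNorm X (ENNReal.ofReal m) P ≤ chainConst c N ρ r m * A := by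
  have hm0 : ENNReal.ofReal m ≠ 0 := by simpa using hm
  have hinc' : ∀ n, ∀ d ∈ D n, ∫⁻ ω, ‖X ω d.1 - X ω d.2‖ₑ ^ m ∂P ≤ (A * r ^ n) ^ m := by
    intro n d hd
    have h := hinc n d hd
    rw [eLpNorm_eq_lintegral_rpow_enorm_toReal hm0 ENNReal.ofReal_ne_top,
      ENNReal.toReal_ofReal hm.le] at h
    have h2 := ENNReal.rpow_le_rpow h hm.le
    rwa [← ENNReal.rpow_mul, one_div, inv_mul_cancel₀ hm.ne', ENNReal.rpow_one] at h2
  have hmeas : ∀ d : K × K, AEMeasurable (fun ω => ‖X ω d.1 - X ω d.2‖ₑ ^ m) P := fun d =>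
    ((hX d.1).sub (hX d.2)).enorm.pow_const m
  have hmain : ∫⁻ ω, ‖X ω‖ₑ ^ m ∂P ≤ (chainConst c N ρ r m * A) ^ m := by
    calc ∫⁻ ω, ‖X ω‖ₑ ^ m ∂P
        ≤ ∫⁻ ω, ((1 - ρ)⁻¹) ^ m *
            ∑' n, ∑ d ∈ D n, (ρ⁻¹ ^ n) ^ m * ‖X ω d.1 - X ω d.2‖ₑ ^ m ∂P := by
          refine lintegral_mono_ae ?_
          filter_upwards [h₀] with ω hω
          exact enorm_rpow_le_tsum (X ω) hω hπ0 hπ hD hρ0 hρ hm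
      _ = ((1 - ρ)⁻¹) ^ m *
            ∑' n, ∑ d ∈ D n, (ρ⁻¹ ^ n) ^ m * ∫⁻ ω, ‖X ω d.1 - X ω d.2‖ₑ ^ m ∂P := by
          have hm1 : ∀ n, ∀ d : K × K, AEMeasurable
              (fun ω => (ρ⁻¹ ^ n) ^ m * ‖X ω d.1 - X ω d.2‖ₑ ^ m) P :=
            fun n d => (hmeas d).const_mul _
          rw [lintegral_const_mul'' _ (AEMeasurable.tsum fun n =>
            Finset.aemeasurable_fun_sum _ fun d _ => hm1 n d),
            lintegral_tsum fun n => Finset.aemeasurable_fun_sum _ fun d _ => hm1 n d]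
          congr 2
          ext n
          rw [lintegral_finsetSum' _ fun d _ => hm1 n d]
          exact Finset.sum_congr rfl fun d _ => lintegral_const_mul'' _ (hmeas d)
      _ ≤ ((1 - ρ)⁻¹) ^ m * ∑' n, (c * A ^ m) * (N * (ρ⁻¹ * r) ^ m) ^ n := by
          gcongr with n
          calc ∑ d ∈ D n, (ρ⁻¹ ^ n) ^ m * ∫⁻ ω, ‖X ω d.1 - X ω d.2‖ₑ ^ m ∂P
              ≤ ∑ d ∈ D n, (ρ⁻¹ ^ n) ^ m * (A * r ^ n) ^ m := by
                refine Finset.sum_le_sum fun d hd => ?_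
                gcongr
                exact hinc' n d hd
            _ = (D n).card * ((ρ⁻¹ ^ n) ^ m * (A * r ^ n) ^ m) := by
                rw [Finset.sum_const, nsmul_eq_mul]
            _ ≤ (c * N ^ n) * ((ρ⁻¹ ^ n) ^ m * (A * r ^ n) ^ m) := by
                gcongr
                exact hcard n
            _ = (c * A ^ m) * (N * (ρ⁻¹ * r) ^ m) ^ n := by
                rw [ENNReal.mul_rpow_of_nonneg _ _ hm.le, ENNReal.mul_rpow_of_nonneg _ _ hm.le,
                  mul_pow, mul_pow]
                simp_rw [← ENNReal.rpow_natCast, ← ENNReal.rpow_mul]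
                rw [mul_comm (n : ℝ) m]
                ring
      _ = (chainConst c N ρ r m * A) ^ m := by
          rw [ENNReal.tsum_mul_left, ENNReal.tsum_geometric, chainConst,
            ENNReal.mul_rpow_of_nonneg _ A hm.le, ENNReal.mul_rpow_of_nonneg (1 - ρ)⁻¹ _ hm.le,
            ← ENNReal.rpow_mul (c * _), one_div, inv_mul_cancel₀ hm.ne', ENNReal.rpow_one]
          ring
  rw [eLpNorm_eq_lintegral_rpow_enorm_toReal hm0 ENNReal.ofReal_ne_top,
    ENNReal.toReal_ofReal hm.le]
  refine (ENNReal.rpow_le_rpow hmain (by positivity)).trans (le_of_eq ?_)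
  rw [← ENNReal.rpow_mul, mul_one_div_cancel hm.ne', ENNReal.rpow_one]

/-- Collects the links of one level: they are counted by pairs of cell indices, yet each comes from
an actual q, so closeness is needed only for true links. -/
lemma exists_finset_of_factors {J S : Type*} [Fintype J] (idx : K → J) (pt : J → S) :
    ∃ D : Finset S, (∀ q, pt (idx q) ∈ D) ∧ (∀ d ∈ D, ∃ q, pt (idx q) = d) ∧
      D.card ≤ Fintype.card J := by
  classical
  refine ⟨(Finset.univ.filter fun j => j ∈ Set.range idx).image pt, fun q => ?_, fun d hd => ?_, ?_⟩
  · exact Finset.mem_image_of_mem _ (by simp)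
  · obtain ⟨j, hj, rfl⟩ := Finset.mem_image.1 hd
    obtain ⟨q, rfl⟩ := (Finset.mem_filter.1 hj).2
    exact ⟨q, rfl⟩
  · exact Finset.card_image_le.trans (Finset.card_filter_le _ _)

end Chaining

/-! ### Dyadic projections of space-time -/

/-- Cells are open on the left, so u = a lies in the last one; truncated subtraction puts u = 0 into
the first. -/
lemma ceil_sub_one_lt {a : ℝ} (n : ℕ) (u : Set.Icc 0 a) :
    ⌈(2 ^ n : ℝ) * (u / a)⌉₊ - 1 < 2 ^ n := by
  have hu1 : (2 ^ n : ℝ) * (u / a) ≤ (2 ^ n : ℕ) := by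
    push_cast
    exact mul_le_of_le_one_right (by positivity)
      (div_le_one_of_le₀ u.2.2 (u.2.1.trans u.2.2))
  have := Nat.ceil_le.2 hu1
  have h2 : 0 < 2 ^ n := by positivity
  omega

/-- The index of the dyadic interval of generation `n` of `[0,a]` that contains `u`. -/
def dyadicIdx {a : ℝ} (n : ℕ) (u : Set.Icc 0 a) : Fin (2 ^ n) :=
  ⟨⌈(2 ^ n : ℝ) * (u / a)⌉₊ - 1, ceil_sub_one_lt n u⟩

/-- The left end points of the dyadic intervals of generation `n` of `[0,a]`. -/
def dyadicPt {a : ℝ} (ha : 0 < a) (n : ℕ) (i : Fin (2 ^ n)) : Set.Icc 0 a :=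
  ⟨a * (i : ℕ) / 2 ^ n, by positivity, by
    have h : ((i : ℕ) : ℝ) ≤ 2 ^ n := by exact_mod_cast i.2.le
    rw [div_le_iff₀ (by positivity)]
    gcongr⟩

lemma dyadicPt_idx {a : ℝ} (ha : 0 < a) (n : ℕ) (u : Set.Icc 0 a) :
    (dyadicPt ha n (dyadicIdx n u) : ℝ) ≤ u ∧
      (u : ℝ) ≤ dyadicPt ha n (dyadicIdx n u) + a / 2 ^ n := by
  have hu0 : 0 ≤ (2 ^ n : ℝ) * (u / a) := by have := u.2.1; positivity
  have hu : (u : ℝ) = a * ((2 ^ n : ℝ) * (u / a)) / 2 ^ n := by field_simp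
  simp only [dyadicPt, dyadicIdx]
  set y := (2 ^ n : ℝ) * (u / a) with hy
  have h1 : ((⌈y⌉₊ - 1 : ℕ) : ℝ) ≤ y := by
    rcases Nat.eq_zero_or_pos ⌈y⌉₊ with h | h
    · simpa [h] using hu0
    · have := Nat.ceil_lt_add_one hu0
      push_cast [Nat.cast_sub h]
      linarith
  have h2 : y ≤ ((⌈y⌉₊ - 1 : ℕ) : ℝ) + 1 :=
    (Nat.le_ceil y).trans (by exact_mod_cast (by omega : ⌈y⌉₊ ≤ ⌈y⌉₊ - 1 + 1))
  constructor
  · rw [hu]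
    gcongr
  · rw [← add_div, hu, div_le_div_iff_of_pos_right (by positivity)]
    nlinarith

lemma dyadicPt_zero {a : ℝ} (ha : 0 < a) (i : Fin (2 ^ 0)) :
    dyadicPt ha 0 i = ⟨0, le_rfl, ha.le⟩ := by
  simp [dyadicPt]

lemma abs_dyadicPt_sub_le {a : ℝ} (ha : 0 < a) (n : ℕ) (u : Set.Icc 0 a) :
    |(dyadicPt ha (n + 1) (dyadicIdx (n + 1) u) : ℝ) - dyadicPt ha n (dyadicIdx n u)| ≤
      a / 2 ^ n := by
  have h1 := dyadicPt_idx ha n u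
  have h2 := dyadicPt_idx ha (n + 1) u
  have h3 : a / 2 ^ (n + 1) ≤ a / 2 ^ n := by
    gcongr
    · norm_num
    · omega
  rw [abs_le]
  constructor <;> linarith [h1.1, h1.2, h2.1, h2.2]

lemma tendsto_dyadicPt {a : ℝ} (ha : 0 < a) (u : Set.Icc 0 a) :
    Tendsto (fun n => dyadicPt ha n (dyadicIdx n u)) atTop (𝓝 u) := by
  rw [tendsto_subtype_rng]
  have hz : Tendsto (fun n : ℕ => (u : ℝ) - a / 2 ^ n) atTop (𝓝 u) := by
    have := (tendsto_inv_atTop_zero.comp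
      (tendsto_pow_atTop_atTop_of_one_lt (r := (2 : ℝ)) (by norm_num))).const_mul a
    simpa [div_eq_mul_inv] using this.const_sub (u : ℝ)
  refine tendsto_of_tendsto_of_tendsto_of_le_of_le hz tendsto_const_nhds (fun n => ?_) (fun n => ?_)
  · have := (dyadicPt_idx ha n u).2
    simp only
    linarith
  · exact (dyadicPt_idx ha n u).1

variable {T L : ℝ}

/-- The dyadic points of generation `n` of space-time. -/
def gridPt (hT : 0 < T) (hL : 0 < L) (n : ℕ) (i : Fin (2 ^ n) × Fin (2 ^ n) × Fin (2 ^ n)) :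
    SpaceTime T L :=
  (dyadicPt hT n i.1, dyadicPt hL n i.2.1, dyadicPt hL n i.2.2)

/-- The index of the dyadic cell of generation `n` that contains `q`. -/
def gridIdx (n : ℕ) (q : SpaceTime T L) : Fin (2 ^ n) × Fin (2 ^ n) × Fin (2 ^ n) :=
  (dyadicIdx n q.1, dyadicIdx n q.2.1, dyadicIdx n q.2.2)

/-- The origin of space-time. -/
def origin (hT : 0 < T) (hL : 0 < L) : SpaceTime T L :=
  (⟨0, le_rfl, hT.le⟩, ⟨0, le_rfl, hL.le⟩, ⟨0, le_rfl, hL.le⟩)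

variable {Ω : Type*} [MeasurableSpace Ω] {P : Measure Ω}

/-- Kolmogorov's bound for the supremum of a continuous random field on space-time. -/
lemma eLpNorm_spaceTime_le (hT : 0 < T) (hL : 0 < L) {X : Ω → C(SpaceTime T L, ℝ)}
    (hX : ∀ q, AEStronglyMeasurable (X · q) P) (h₀ : ∀ᵐ ω ∂P, X ω (origin hT hL) = 0)
    {ρ r A : ℝ≥0∞} (hρ0 : ρ ≠ 0) (hρ : ρ ≠ ⊤) {m : ℝ} (hm : 0 < m)
    (hinc : ∀ n : ℕ, ∀ p p' : SpaceTime T L, |(p.1 : ℝ) - p'.1| ≤ T / 2 ^ n →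
      |(p.2.1 : ℝ) - p'.2.1| ≤ L / 2 ^ n → |(p.2.2 : ℝ) - p'.2.2| ≤ L / 2 ^ n →
      eLpNorm (fun ω => X ω p - X ω p') (ENNReal.ofReal m) P ≤ A * r ^ n) :
    eLpNorm X (ENNReal.ofReal m) P ≤ chainConst 8 64 ρ r m * A := by
  choose D hD1 hD2 hD3 using fun n : ℕ => exists_finset_of_factors
    (fun q : SpaceTime T L => (gridIdx (n + 1) q, gridIdx n q))
    (fun j => (gridPt hT hL (n + 1) j.1, gridPt hT hL n j.2))
  refine eLpNorm_le_of_increments hX h₀ (π := fun n q => gridPt hT hL n (gridIdx n q))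
    (fun q => ?_) (fun q => ?_) hD1 (fun n => ?_) hρ0 hρ hm (fun n d hd => ?_)
  · simp [gridPt, origin, dyadicPt_zero]
  · exact (tendsto_dyadicPt hT _).prodMk_nhds
      ((tendsto_dyadicPt hL _).prodMk_nhds (tendsto_dyadicPt hL _))
  · have h := hD3 n
    simp only [Fintype.card_prod, Fintype.card_fin] at h
    -- A crude count of all pairs of cells of generations n + 1 and n in three dimensions.
    have h2 : 2 ^ (n + 1) * (2 ^ (n + 1) * 2 ^ (n + 1)) * (2 ^ n * (2 ^ n * 2 ^ n)) =
        8 * 64 ^ n := by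
      rw [show (64 : ℕ) = 2 ^ 6 by norm_num, ← pow_mul]
      ring
    rw [h2] at h
    exact_mod_cast h
  · obtain ⟨q, rfl⟩ := hD2 n d hd
    exact hinc n _ _ (abs_dyadicPt_sub_le hT n q.1) (abs_dyadicPt_sub_le hL n q.2.1)
      (abs_dyadicPt_sub_le hL n q.2.2)

lemma chainConst_ne_top {c N ρ r : ℝ≥0∞} {m : ℝ} (hm : 0 < m) (hc : c ≠ ⊤) (hρ : ρ < 1)
    (h : N * (ρ⁻¹ * r) ^ m < 1) : chainConst c N ρ r m ≠ ⊤ := by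
  refine ENNReal.mul_ne_top (ENNReal.inv_ne_top.2 (tsub_pos_of_lt hρ).ne') ?_
  refine ENNReal.rpow_ne_top_of_nonneg (by positivity) (ENNReal.mul_ne_top hc ?_)
  exact ENNReal.inv_ne_top.2 (tsub_pos_of_lt h).ne'

end

section

/-! ### Measurability of random continuous functions -/

/-- Evaluation on a dense sequence is a continuous injection of the Polish space C(K) into a
countable product of lines, hence a measurable embedding (Lusin–Souslin). -/
lemma aestronglyMeasurable_continuousMap {Ω K : Type*} [MeasurableSpace Ω] {P : Measure Ω}
    [TopologicalSpace K] [CompactSpace K] [T2Space K] [SecondCountableTopology K]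
    {X : Ω → C(K, ℝ)}
    (hX : ∀ q, AEStronglyMeasurable (X · q) P) : AEStronglyMeasurable X P := by
  rcases isEmpty_or_nonempty K with hK | hK
  · have : X = fun _ => 0 := by
      ext ω q
      exact (hK.false q).elim
    rw [this]
    exact aestronglyMeasurable_const
  borelize C(K, ℝ)
  obtain ⟨u, hu⟩ := TopologicalSpace.exists_dense_seq K
  have hcont : Continuous fun (f : C(K, ℝ)) (n : ℕ) => f (u n) :=
    continuous_pi fun n => continuous_eval_const (u n)
  have hinj : Function.Injective fun (f : C(K, ℝ)) (n : ℕ) => f (u n) := by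
    intro f g hfg
    refine DFunLike.coe_injective (hu.equalizer f.continuous g.continuous ?_)
    ext n
    exact congrFun hfg n
  have hemb := hcont.measurableEmbedding hinj
  have : AEMeasurable X P :=
    hemb.aemeasurable_comp_iff.1 (aemeasurable_pi_lambda _ fun n => (hX (u n)).aemeasurable)
  exact this.aestronglyMeasurable

/-! ### The modes of the stochastic convolution -/

variable {Ω : Type*} [MeasurableSpace Ω] {P : Measure Ω} {T L : ℝ} {β : Mode → ℝ≥0 → Ω → ℝ}

lemma isWienerIntegral_convMode (hB : ∀ k, IsBrownianReal (β k) P) (L : ℝ) (k : Mode) (t : ℝ≥0) :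
    IsWienerIntegral P (β k) t (kernel L k t) (convMode P L β k t) := by
  have h : ∃ I, IsWienerIntegral P (β k) t (kernel L k t) I :=
    ⟨_, isWienerIntegral_ouPath (hB k) (sq_nonneg (eigenvalue L k)) t⟩
  rw [convMode, wienerIntegral, dif_pos h]
  exact h.choose_spec

/-- The pathwise version of `Z_k(t)`. -/
def ouMode (L : ℝ) (β : Mode → ℝ≥0 → Ω → ℝ) (k : Mode) (t : ℝ) (ω : Ω) : ℝ :=
  ouPath (eigenvalue L k ^ 2) (β k · ω) t

lemma isWienerPair_ouMode (hB : ∀ k, IsBrownianReal (β k) P) (L : ℝ) (k : Mode) {t : ℝ}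
    (ht : 0 ≤ t) : IsWienerPair P (β k) (ouInd (eigenvalue L k ^ 2) t) (ouMode L β k t) := by
  lift t to ℝ≥0 using ht
  exact (isWienerIntegral_ouPath (hB k) (sq_nonneg (eigenvalue L k)) t).isWienerPair
    (memLp_ouKernel (sq_nonneg _) t)

/-- The chosen integrals carry no regularity in t; uniqueness gives agreement with the pathwise
version off a null set that may depend on t. -/
lemma convMode_ae_eq (hB : ∀ k, IsBrownianReal (β k) P) (L : ℝ) (k : Mode) (t : ℝ≥0) :
    convMode P L β k t =ᵐ[P] ouMode L β k t :=
  ((isWienerIntegral_convMode hB L k t).isWienerPair (memLp_ouKernel (sq_nonneg _) t)).ae_eq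
    (hB k).toIsPreBrownianReal (isWienerPair_ouMode hB L k t.2)

lemma continuous_eigenfunction (L : ℝ) (k : Mode) :
    Continuous fun x : ℝ × ℝ => eigenfunction L k x.1 x.2 :=
  ((continuous_trigBasis L _).comp continuous_fst).mul
    ((continuous_trigBasis L _).comp continuous_snd)

open scoped Classical in
/-- The random field `Z_k(t) e_k(x)` with values in the continuous functions. -/
def modeField (T L : ℝ) (β : Mode → ℝ≥0 → Ω → ℝ) (k : Mode) (ω : Ω) : C(SpaceTime T L, ℝ) :=
  -- Paths are continuous only almost surely; the value 0 elsewhere keeps the field in C for every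
  -- ω.
  if h : Continuous (β k · ω) then
    ⟨fun q => ouMode L β k q.1 ω * eigenfunction L k q.2.1 q.2.2,
      ((continuous_ouPath _ h).comp (by fun_prop)).mul ((continuous_eigenfunction L k).comp
        (g := fun x : ℝ × ℝ => eigenfunction L k x.1 x.2)
        (f := fun q : SpaceTime T L => ((q.2.1 : ℝ), (q.2.2 : ℝ))) (by fun_prop))⟩
  else 0

lemma modeField_ae_eq (hB : ∀ k, IsBrownianReal (β k) P) (T L : ℝ) (k : Mode) :
    ∀ᵐ ω ∂P, ∀ q, modeField T L β k ω q = ouMode L β k q.1 ω * eigenfunction L k q.2.1 q.2.2 := by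
  filter_upwards [(hB k).cont] with ω hω q
  rw [modeField, dif_pos hω]
  rfl

lemma aestronglyMeasurable_modeField (hB : ∀ k, IsBrownianReal (β k) P) (T L : ℝ) (k : Mode) :
    AEStronglyMeasurable (modeField T L β k) P := by
  refine aestronglyMeasurable_continuousMap fun q => ?_
  refine ((isWienerPair_ouMode hB L k q.1.2.1).2.1.mul_const
    (eigenfunction L k q.2.1 q.2.2)).congr ?_
  filter_upwards [modeField_ae_eq hB T L k] with ω hω
  exact (hω q).symm

/-! ### Finite linear combinations of random vectors -/

section WeightedSum

variable {ι E : Type*} [NormedAddCommGroup E] [NormedSpace ℝ E]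

/-- The linear combination `∑_{k ∈ F} a_k f_k` of random variables in a normed space. -/
def weightedSum (a : ι → ℝ) (f : ι → Ω → E) (F : Finset ι) : Ω → E := ∑ k ∈ F, a k • f k

lemma weightedSum_empty {Ω : Type*} (a : ι → ℝ) (f : ι → Ω → E) : weightedSum a f ∅ = 0 := by
  simp [weightedSum]

lemma weightedSum_cons {Ω : Type*} (a : ι → ℝ) (f : ι → Ω → E) {F : Finset ι} {k : ι} (hk : k ∉ F) (ω : Ω) :
    weightedSum a f (F.cons k hk) ω = a k • f k ω + weightedSum a f F ω := by
  simp [weightedSum]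

lemma memLp_weightedSum (a : ι → ℝ) {f : ι → Ω → E} {m : ℝ≥0∞} (hf : ∀ k, MemLp (f k) m P)
    (F : Finset ι) : MemLp (weightedSum a f F) m P :=
  memLp_finsetSum' F fun k _ => (hf k).const_smul (a k)

lemma aestronglyMeasurable_weightedSum (a : ι → ℝ) {f : ι → Ω → E}
    (hf : ∀ k, AEStronglyMeasurable (f k) P) (F : Finset ι) :
    AEStronglyMeasurable (weightedSum a f F) P :=
  Finset.aestronglyMeasurable_sum F fun k _ => (hf k).const_smul (a k)

lemma sum_toLp_eq_toLp_weightedSum (a : ι → ℝ) {f : ι → Ω → E} {m : ℝ≥0∞}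
    (hf : ∀ k, MemLp (f k) m P) (F : Finset ι) :
    ∑ k ∈ F, a k • (hf k).toLp = (memLp_weightedSum a hf F).toLp := by
  induction F using Finset.cons_induction with
  | empty => exact (MemLp.toLp_zero (memLp_weightedSum a hf ∅)).symm
  | cons k F hk ih =>
    rw [Finset.sum_cons, ih, ← MemLp.toLp_const_smul, ← MemLp.toLp_add]
    exact MemLp.toLp_congr _ _ (Eventually.of_forall fun ω => (weightedSum_cons a f hk ω).symm)

end WeightedSum

lemma weightedSum_continuousMap_apply {Ω ι K : Type*} [TopologicalSpace K] [CompactSpace K]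
    (a : ι → ℝ) (f : ι → Ω → C(K, ℝ)) (F : Finset ι) (ω : Ω) (q : K) :
    weightedSum a f F ω q = ∑ k ∈ F, a k * f k ω q := by
  induction F using Finset.cons_induction with
  | empty => rw [weightedSum_empty, Finset.sum_empty]; rfl
  | cons k F hk ih => rw [weightedSum_cons, Finset.sum_cons, ← ih]; rfl

/-- The partial sums of the series defining the stochastic convolution. -/
def partialField (T L : ℝ) (β : Mode → ℝ≥0 → Ω → ℝ) (a : Mode → ℝ) (F : Finset Mode) :
    Ω → C(SpaceTime T L, ℝ) :=
  weightedSum a (modeField T L β) F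

lemma aestronglyMeasurable_partialField (hB : ∀ k, IsBrownianReal (β k) P) (T L : ℝ)
    (a : Mode → ℝ) (F : Finset Mode) : AEStronglyMeasurable (partialField T L β a F) P :=
  aestronglyMeasurable_weightedSum a (fun k => aestronglyMeasurable_modeField hB T L k) F

/-- There are countably many modes, so one null set serves all space-time points. -/
lemma partialField_ae_eq (hB : ∀ k, IsBrownianReal (β k) P) (T L : ℝ) (a : Mode → ℝ)
    (F : Finset Mode) : ∀ᵐ ω ∂P, ∀ q, partialField T L β a F ω q =
      ∑ k ∈ F, a k * ouMode L β k q.1 ω * eigenfunction L k q.2.1 q.2.2 := by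
  filter_upwards [ae_all_iff.2 fun k : Mode => modeField_ae_eq hB T L k] with ω hω q
  rw [partialField, weightedSum_continuousMap_apply]
  exact Finset.sum_congr rfl fun k _ => by rw [hω k q]; ring

/-! ### Dyadic increments and the supremum of the partial sums -/

lemma div_two_pow_rpow {c : ℝ} (hc : 0 ≤ c) (δ : ℝ) (n : ℕ) :
    (c / 2 ^ n) ^ δ = c ^ δ * ((2 : ℝ) ^ (-δ)) ^ n := by
  rw [Real.div_rpow hc (by positivity), div_eq_mul_inv, ← Real.rpow_natCast, ← Real.rpow_natCast,
    ← Real.rpow_mul zero_le_two, ← Real.rpow_mul zero_le_two, ← Real.rpow_neg zero_le_two]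
  ring_nf

/-- The Hölder constant of the random field. -/
def holderConst (T L δ : ℝ) : ℝ := 2 / L * (T ^ δ + 4 * L ^ (4 * δ))

lemma eLpNorm_increment_kernel_le (hT : 0 < T) (hL : 0 < L) {δ : ℝ} (h0 : 0 < δ)
    (h1 : δ < 1 / 4) (k : Mode) (n : ℕ) {p p' : SpaceTime T L}
    (d₀ : |(p.1 : ℝ) - p'.1| ≤ T / 2 ^ n) (d₁ : |(p.2.1 : ℝ) - p'.2.1| ≤ L / 2 ^ n)
    (d₂ : |(p.2.2 : ℝ) - p'.2.2| ≤ L / 2 ^ n) :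
    eLpNorm (eigenfunction L k p.2.1 p.2.2 • ouInd (eigenvalue L k ^ 2) p.1 +
      (-eigenfunction L k p'.2.1 p'.2.2) • ouInd (eigenvalue L k ^ 2) p'.1) 2 volume ≤
      ENNReal.ofReal (eigenvalue L k ^ (2 * δ - 1) * (holderConst T L δ * ((2 : ℝ) ^ (-δ)) ^ n)) := by
  have hμ := eigenvalue_pos hL k
  set μ := eigenvalue L k with hμdef
  -- Change the time with the eigenfunction frozen, then the point with the kernel frozen.
  have hdec : eigenfunction L k p.2.1 p.2.2 • ouInd (μ ^ 2) p.1 +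
      (-eigenfunction L k p'.2.1 p'.2.2) • ouInd (μ ^ 2) p'.1 =
      eigenfunction L k p.2.1 p.2.2 • (ouInd (μ ^ 2) p.1 - ouInd (μ ^ 2) p'.1) +
      (eigenfunction L k p.2.1 p.2.2 - eigenfunction L k p'.2.1 p'.2.2) •
        ouInd (μ ^ 2) p'.1 := by
    rw [smul_sub, sub_smul, neg_smul]; abel
  have m₁ := memLp_ouInd (sq_nonneg μ) (p.1 : ℝ)
  have m₂ := memLp_ouInd (sq_nonneg μ) (p'.1 : ℝ)
  rw [hdec]
  refine (eLpNorm_add_le ((m₁.sub m₂).const_smul _).1 (m₂.const_smul _).1 (by norm_num)).trans ?_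
  rw [eLpNorm_const_smul, eLpNorm_const_smul, Real.enorm_eq_ofReal_abs, Real.enorm_eq_ofReal_abs]
  refine (add_le_add (mul_le_mul' (ENNReal.ofReal_le_ofReal (abs_eigenfunction_le hL k _ _))
    (eLpNorm_ouInd_sub_le hμ p'.1.2.1 p.1.2.1 h0.le (by linarith)))
    (mul_le_mul' (ENNReal.ofReal_le_ofReal (abs_eigenfunction_sub_le hL k _ _ _ _ h0.le
      (by linarith))) (eLpNorm_ouInd_le hμ p'.1.2.1))).trans ?_
  rw [← ENNReal.ofReal_mul (by positivity), ← ENNReal.ofReal_mul (by positivity),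
    ← ENNReal.ofReal_add (by positivity) (by positivity)]
  refine ENNReal.ofReal_le_ofReal ?_
  have b₀ : |(p.1 : ℝ) - p'.1| ^ δ ≤ T ^ δ * ((2 : ℝ) ^ (-δ)) ^ n :=
    (Real.rpow_le_rpow (abs_nonneg _) d₀ h0.le).trans_eq (div_two_pow_rpow hT.le δ n)
  -- The spatial part decays faster; only the rate 2^(-δn) of the time part is kept.
  have hle : ((2 : ℝ) ^ (-(4 * δ))) ^ n ≤ ((2 : ℝ) ^ (-δ)) ^ n :=
    pow_le_pow_left₀ (by positivity)
      (Real.rpow_le_rpow_of_exponent_le (by norm_num) (by linarith)) n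
  have b : ∀ x : ℝ, |x| ≤ L / 2 ^ n → |x| ^ (4 * δ) ≤ L ^ (4 * δ) * ((2 : ℝ) ^ (-δ)) ^ n := by
    intro x hx
    refine ((Real.rpow_le_rpow (abs_nonneg _) hx (by positivity)).trans_eq
      (div_two_pow_rpow hL.le (4 * δ) n)).trans ?_
    exact mul_le_mul_of_nonneg_left hle (by positivity)
  have b₁ := b _ d₁
  have b₂ := b _ d₂
  have hpow : μ ^ (2 * δ - 1) = μ⁻¹ * μ ^ (2 * δ) := by
    rw [Real.rpow_sub_one hμ.ne']; ring
  rw [hpow, holderConst]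
  calc _ = 2 / L * (μ⁻¹ * μ ^ (2 * δ)) * (|(p.1 : ℝ) - p'.1| ^ δ +
        2 * (|(p.2.1 : ℝ) - p'.2.1| ^ (4 * δ) + |(p.2.2 : ℝ) - p'.2.2| ^ (4 * δ))) := by ring
    _ ≤ 2 / L * (μ⁻¹ * μ ^ (2 * δ)) * (T ^ δ * ((2 : ℝ) ^ (-δ)) ^ n +
        2 * (L ^ (4 * δ) * ((2 : ℝ) ^ (-δ)) ^ n + L ^ (4 * δ) * ((2 : ℝ) ^ (-δ)) ^ n)) := by
      gcongr
    _ = _ := by ring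

/-- The weights of the modes in the bound for the supremum. -/
def weight (L : ℝ) (a : Mode → ℝ) (δ : ℝ) (k : Mode) : ℝ :=
  a k ^ 2 * eigenvalue L k ^ (4 * δ - 2)

lemma weight_nonneg {L : ℝ} (hL : 0 < L) (a : Mode → ℝ) (δ : ℝ) (k : Mode) :
    0 ≤ weight L a δ k :=
  mul_nonneg (sq_nonneg _) (Real.rpow_nonneg (eigenvalue_pos hL k).le _)

lemma eLpNorm_increment_le [IsProbabilityMeasure P] (hB : ∀ k, IsBrownianReal (β k) P)
    (hind : iIndepFun (fun k ω (t : ℝ≥0) => β k t ω) P) (hT : 0 < T) (hL : 0 < L)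
    (a : Mode → ℝ) {δ : ℝ} (h0 : 0 < δ) (h1 : δ < 1 / 4) (F : Finset Mode) {m : ℝ≥0∞}
    (hm : m ≠ ⊤) (n : ℕ) (p p' : SpaceTime T L)
    (d₀ : |(p.1 : ℝ) - p'.1| ≤ T / 2 ^ n) (d₁ : |(p.2.1 : ℝ) - p'.2.1| ≤ L / 2 ^ n)
    (d₂ : |(p.2.2 : ℝ) - p'.2.2| ≤ L / 2 ^ n) :
    eLpNorm (fun ω => partialField T L β a F ω p - partialField T L β a F ω p') m P ≤
      gaussNorm m * ENNReal.ofReal (holderConst T L δ) *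
        ENNReal.ofReal (√(∑ k ∈ F, weight L a δ k)) * ENNReal.ofReal ((2 : ℝ) ^ (-δ)) ^ n := by
  set c := holderConst T L δ with hc
  have hcpos : 0 ≤ c := by rw [hc, holderConst]; positivity
  set s := ((2 : ℝ) ^ (-δ)) ^ n with hs
  have hspos : 0 ≤ s := by positivity
  have hpair : ∀ k, IsWienerPair P (β k)
      (a k • (eigenfunction L k p.2.1 p.2.2 • ouInd (eigenvalue L k ^ 2) p.1 +
        (-eigenfunction L k p'.2.1 p'.2.2) • ouInd (eigenvalue L k ^ 2) p'.1))
      (a k • (eigenfunction L k p.2.1 p.2.2 • ouMode L β k p.1 +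
        (-eigenfunction L k p'.2.1 p'.2.2) • ouMode L β k p'.1)) := fun k => by
    simp_rw [smul_add, smul_smul]
    exact (isWienerPair_ouMode hB L k p.1.2.1).combination (hB k).toIsPreBrownianReal
      (isWienerPair_ouMode hB L k p'.1.2.1) _ _
  have hcongr : (fun ω => partialField T L β a F ω p - partialField T L β a F ω p') =ᵐ[P]
      ∑ k ∈ F, a k • (eigenfunction L k p.2.1 p.2.2 • ouMode L β k p.1 +
        (-eigenfunction L k p'.2.1 p'.2.2) • ouMode L β k p'.1) := by
    filter_upwards [partialField_ae_eq hB T L a F] with ω hω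
    rw [hω, hω, ← Finset.sum_sub_distrib, Finset.sum_apply]
    refine Finset.sum_congr rfl fun k _ => ?_
    simp only [Pi.smul_apply, Pi.add_apply, smul_eq_mul]
    ring
  rw [eLpNorm_congr_ae hcongr]
  refine (eLpNorm_sum_wienerPair_le (fun k => (hB k).toIsPreBrownianReal) hind F hpair hm).trans ?_
  rw [mul_assoc, mul_assoc]
  gcongr
  have hk : ∀ k, eLpNorm (a k • (eigenfunction L k p.2.1 p.2.2 • ouInd (eigenvalue L k ^ 2) p.1 +
        (-eigenfunction L k p'.2.1 p'.2.2) • ouInd (eigenvalue L k ^ 2) p'.1)) 2 volume ^ 2 ≤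
      ENNReal.ofReal ((c * s) ^ 2 * weight L a δ k) := by
    intro k
    have hμ := eigenvalue_pos hL k
    rw [eLpNorm_const_smul, Real.enorm_eq_ofReal_abs]
    refine (pow_le_pow_left' (mul_le_mul_right
      (eLpNorm_increment_kernel_le hT hL h0 h1 k n d₀ d₁ d₂) _) 2).trans (le_of_eq ?_)
    rw [← ENNReal.ofReal_mul (abs_nonneg _), ← ENNReal.ofReal_pow (by positivity)]
    congr 1
    have : eigenvalue L k ^ (4 * δ - 2) = (eigenvalue L k ^ (2 * δ - 1)) ^ 2 := by
      rw [← Real.rpow_natCast, ← Real.rpow_mul hμ.le]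
      congr 1
      push_cast; ring
    rw [weight, this, mul_pow, sq_abs]
    ring
  refine (ENNReal.rpow_le_rpow (Finset.sum_le_sum fun k _ => hk k) (by norm_num)).trans
    (le_of_eq ?_)
  rw [← ENNReal.ofReal_sum_of_nonneg fun k _ => mul_nonneg (sq_nonneg _) (weight_nonneg hL a δ k),
    ← Finset.mul_sum, ENNReal.ofReal_rpow_of_nonneg (mul_nonneg (sq_nonneg _)
      (Finset.sum_nonneg fun k _ => weight_nonneg hL a δ k)) (by norm_num), ← Real.sqrt_eq_rpow,
    Real.sqrt_mul (sq_nonneg _), Real.sqrt_sq (by positivity),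
    ← ENNReal.ofReal_pow (by positivity), ← ENNReal.ofReal_mul (by positivity),
    ← ENNReal.ofReal_mul hcpos]
  congr 1
  ring

/-- The constant in the bound for the moment of order `m`. -/
def fieldConst (T L δ m : ℝ) : ℝ≥0∞ :=
  chainConst 8 64 (ENNReal.ofReal ((2 : ℝ) ^ (-(δ / 2)))) (ENNReal.ofReal ((2 : ℝ) ^ (-δ))) m *
    (gaussNorm (ENNReal.ofReal m) * ENNReal.ofReal (holderConst T L δ))

/-- With ρ = 2^(-δ/2), r = 2^(-δ) and N = 64 the chaining ratio is 2^(6 - mδ/2), which is below 1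
exactly when m > 12/δ. -/
lemma fieldConst_ne_top (T L : ℝ) {δ m : ℝ} (hδ : 0 < δ) (hm : 12 / δ < m) :
    fieldConst T L δ m ≠ ⊤ := by
  have hm0 : 0 < m := lt_trans (by positivity) hm
  have hρ : (0 : ℝ) < 2 ^ (-(δ / 2)) := by positivity
  refine ENNReal.mul_ne_top (chainConst_ne_top hm0 (by norm_num) ?_ ?_)
    (ENNReal.mul_ne_top (gaussNorm_ne_top ENNReal.ofReal_ne_top) ENNReal.ofReal_ne_top)
  · rw [← ENNReal.ofReal_one]
    exact (ENNReal.ofReal_lt_ofReal_iff one_pos).2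
      (Real.rpow_lt_one_of_one_lt_of_neg one_lt_two (by linarith))
  · have h64 : (64 : ℝ≥0∞) = ENNReal.ofReal ((2 : ℝ) ^ (6 : ℝ)) := by norm_num
    rw [← ENNReal.ofReal_inv_of_pos hρ, ← ENNReal.ofReal_mul (by positivity),
      ENNReal.ofReal_rpow_of_nonneg (by positivity) hm0.le, h64,
      ← ENNReal.ofReal_mul (by positivity), ← ENNReal.ofReal_one]
    refine (ENNReal.ofReal_lt_ofReal_iff one_pos).2 ?_
    rw [← Real.rpow_neg zero_le_two, ← Real.rpow_add two_pos, ← Real.rpow_mul zero_le_two,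
      ← Real.rpow_add two_pos]
    refine Real.rpow_lt_one_of_one_lt_of_neg one_lt_two ?_
    have := (div_lt_iff₀ hδ).1 hm
    nlinarith

lemma eLpNorm_partialField_le [IsProbabilityMeasure P] (hB : ∀ k, IsBrownianReal (β k) P)
    (hind : iIndepFun (fun k ω (t : ℝ≥0) => β k t ω) P) (hT : 0 < T) (hL : 0 < L)
    (a : Mode → ℝ) {δ : ℝ} (h0 : 0 < δ) (h1 : δ < 1 / 4) {m : ℝ} (hm : 0 < m)
    (F : Finset Mode) : eLpNorm (partialField T L β a F) (ENNReal.ofReal m) P ≤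
      fieldConst T L δ m * ENNReal.ofReal (√(∑ k ∈ F, weight L a δ k)) := by
  have hzero : ∀ᵐ ω ∂P, partialField T L β a F ω (origin hT hL) = 0 := by
    filter_upwards [partialField_ae_eq hB T L a F,
      ae_all_iff.2 fun k : Mode => (hB k).eval_zero_ae_eq_zero] with ω hω hω0
    rw [hω]
    refine Finset.sum_eq_zero fun k _ => ?_
    simp [origin, ouMode, ouPath_zero, hω0 k]
  have hmeas : ∀ q, AEStronglyMeasurable (partialField T L β a F · q) P := fun q =>
    (continuous_eval_const q).comp_aestronglyMeasurable
      (aestronglyMeasurable_partialField hB T L a F)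
  refine (eLpNorm_spaceTime_le hT hL hmeas hzero
    (ρ := ENNReal.ofReal ((2 : ℝ) ^ (-(δ / 2)))) (ENNReal.ofReal_pos.2 (by positivity)).ne'
    ENNReal.ofReal_ne_top hm fun n p p' d₀ d₁ d₂ =>
      eLpNorm_increment_le hB hind hT hL a h0 h1 F ENNReal.ofReal_ne_top n p p' d₀ d₁ d₂).trans
    (le_of_eq ?_)
  rw [fieldConst]
  ring

end

section

/-! ### Convergence of the series -/

variable {Ω : Type*} [MeasurableSpace Ω] {P : Measure Ω} {T L : ℝ} {β : Mode → ℝ≥0 → Ω → ℝ}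

lemma summable_weight {L : ℝ} (hL : 0 < L) {a : Mode → ℝ} {M : ℝ} (ha : ∀ k, |a k| ≤ M) {δ : ℝ}
    (h1 : δ < 1 / 4) : Summable (weight L a δ) := by
  refine ((summable_eigenvalue_rpow hL h1).mul_left (M ^ 2)).of_nonneg_of_le
    (weight_nonneg hL a δ) fun k => ?_
  refine mul_le_mul_of_nonneg_right ?_ (Real.rpow_nonneg (eigenvalue_pos hL k).le _)
  rw [← sq_abs]
  exact pow_le_pow_left₀ (abs_nonneg _) (ha k) 2

/-- A single mode is a partial sum over a singleton. The sample value δ = 1/8 gives the threshold 96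
= 12/δ. -/
lemma memLp_modeField [IsProbabilityMeasure P] (hB : ∀ k, IsBrownianReal (β k) P)
    (hind : iIndepFun (fun k ω (t : ℝ≥0) => β k t ω) P) (hT : 0 < T) (hL : 0 < L)
    {m : ℝ} (hm : 96 < m) (k : Mode) : MemLp (modeField T L β k) (ENNReal.ofReal m) P := by
  refine ⟨aestronglyMeasurable_modeField hB T L k, ?_⟩
  have h := eLpNorm_partialField_le hB hind hT hL (fun _ => 1) (δ := 1 / 8) (by norm_num)
    (by norm_num) (m := m) (by linarith) {k}
  have h2 : partialField T L β (fun _ => 1) {k} = modeField T L β k := by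
    simp [partialField, weightedSum]
  rw [h2] at h
  exact h.trans_lt (ENNReal.mul_lt_top (fieldConst_ne_top T L (by norm_num)
    (by norm_num; exact hm)).lt_top ENNReal.ofReal_lt_top)

/-- A series in a Banach space is summable if its finite partial sums are controlled by the square
roots of the partial sums of a summable series. -/
lemma summable_of_norm_sum_le_sqrt {E ι : Type*} [NormedAddCommGroup E] [CompleteSpace E]
    {f : ι → E} {w : ι → ℝ} (hw : Summable w) {C : ℝ} (hC : 0 ≤ C)
    (h : ∀ F : Finset ι, ‖∑ k ∈ F, f k‖ ≤ C * √(∑ k ∈ F, w k)) : Summable f := by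
  rw [summable_iff_vanishing_norm]
  intro ε hε
  have hCp : 0 < C + 1 := by positivity
  obtain ⟨s, hs⟩ := summable_iff_vanishing_norm.1 hw ((ε / (C + 1)) ^ 2) (by positivity)
  refine ⟨s, fun t ht => (h t).trans_lt ?_⟩
  have h1 : √(∑ k ∈ t, w k) ≤ ε / (C + 1) :=
    Real.sqrt_le_iff.2 ⟨by positivity, (Real.le_norm_self _).trans (hs t ht).le⟩
  calc C * √(∑ k ∈ t, w k) ≤ C * (ε / (C + 1)) := by gcongr
    _ < ε := by
        rw [mul_div_assoc', div_lt_iff₀ hCp]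
        nlinarith

/-- Summation takes place in the complete space L^m(Ω; C), so the limit has continuous samples by
construction. -/
lemma exists_tendsto_partialField [IsProbabilityMeasure P] (hB : ∀ k, IsBrownianReal (β k) P)
    (hind : iIndepFun (fun k ω (t : ℝ≥0) => β k t ω) P) (hT : 0 < T) (hL : 0 < L)
    {a : Mode → ℝ} {M : ℝ} (ha : ∀ k, |a k| ≤ M) {m : ℝ} (hm : 96 < m) :
    ∃ Y : Ω → C(SpaceTime T L, ℝ), MemLp Y (ENNReal.ofReal m) P ∧
      Tendsto (fun F => eLpNorm (partialField T L β a F - Y) (ENNReal.ofReal m) P)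
        atTop (𝓝 0) := by
  have : Fact (1 ≤ ENNReal.ofReal m) := ⟨by rw [ENNReal.one_le_ofReal]; linarith⟩
  have hmem := fun k => memLp_modeField hB hind hT hL hm k
  have hmemF : ∀ F, MemLp (partialField T L β a F) (ENNReal.ofReal m) P :=
    memLp_weightedSum a hmem
  have hsum : ∀ F : Finset Mode, ∑ k ∈ F, a k • (hmem k).toLp = (hmemF F).toLp :=
    sum_toLp_eq_toLp_weightedSum a hmem
  have hCtop : fieldConst T L (1 / 8) m ≠ ⊤ :=
    fieldConst_ne_top T L (by norm_num) (by norm_num; exact hm)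
  have hsummable : Summable fun k => a k • (hmem k).toLp := by
    refine summable_of_norm_sum_le_sqrt (summable_weight hL ha (δ := 1 / 8) (by norm_num))
      (ENNReal.toReal_nonneg (a := fieldConst T L (1 / 8) m)) fun F => ?_
    rw [hsum, Lp.norm_toLp, ← ENNReal.toReal_ofReal (Real.sqrt_nonneg _), ← ENNReal.toReal_mul]
    exact ENNReal.toReal_mono (ENNReal.mul_ne_top hCtop ENNReal.ofReal_ne_top)
      (eLpNorm_partialField_le hB hind hT hL a (by norm_num) (by norm_num) (by linarith) F)
  obtain ⟨Y, hY⟩ := hsummable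
  rw [HasSum, SummationFilter.unconditional_filter] at hY
  simp_rw [hsum] at hY
  refine ⟨Y, Lp.memLp Y, ?_⟩
  rw [← Lp.tendsto_Lp_iff_tendsto_eLpNorm'' _ hmemF _ (Lp.memLp Y), Lp.toLp_coeFn]
  exact hY

/-- Convergence in one exponent m₀ gives convergence in measure, and Fatou then yields the bound in
every other exponent. Thus one Y serves all m and δ. -/
lemma eLpNorm_limit_le [IsProbabilityMeasure P] (hB : ∀ k, IsBrownianReal (β k) P)
    (hind : iIndepFun (fun k ω (t : ℝ≥0) => β k t ω) P) (hT : 0 < T) (hL : 0 < L)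
    {a : Mode → ℝ} {M : ℝ} (ha : ∀ k, |a k| ≤ M) {Y : Ω → C(SpaceTime T L, ℝ)} {m₀ : ℝ≥0∞}
    (hm₀ : m₀ ≠ 0) (hY : AEStronglyMeasurable Y P)
    (hlim : Tendsto (fun F => eLpNorm (partialField T L β a F - Y) m₀ P) atTop (𝓝 0))
    {δ : ℝ} (h0 : 0 < δ) (h1 : δ < 1 / 4) {m : ℝ} (hm : 0 < m) :
    eLpNorm Y (ENNReal.ofReal m) P ≤
      fieldConst T L δ m * ENNReal.ofReal (√(∑' k, weight L a δ k)) := by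
  have hmeas := fun F => aestronglyMeasurable_partialField hB T L a F
  refine eLpNorm_le_of_tendstoInMeasure (Eventually.of_forall fun F => ?_)
    (tendstoInMeasure_of_tendsto_eLpNorm hm₀ hmeas hY hlim) hmeas
  refine (eLpNorm_partialField_le hB hind hT hL a h0 h1 hm F).trans ?_
  gcongr
  exact (summable_weight hL ha h1).sum_le_tsum F fun k _ => weight_nonneg hL a δ k

/-- Evaluation at a point is bounded by the sup norm, and on a probability space the L² norm by the
L^m norm. -/
lemma isContinuousVersion_of_tendsto [IsProbabilityMeasure P] (hB : ∀ k, IsBrownianReal (β k) P)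
    {a : Mode → ℝ} {Y : Ω → C(SpaceTime T L, ℝ)} {m : ℝ≥0∞} (hm : 2 ≤ m) (hY : MemLp Y m P)
    (hlim : Tendsto (fun F => eLpNorm (partialField T L β a F - Y) m P) atTop (𝓝 0)) :
    IsContinuousVersion P T L β a Y := by
  intro q
  set t : ℝ≥0 := (q.1 : ℝ).toNNReal with ht
  have htq : (t : ℝ) = q.1 := Real.coe_toNNReal _ q.1.2.1
  refine ⟨fun k => ?_, ?_, ?_⟩
  · exact ((isWienerIntegral_convMode hB L k t).1.const_mul (a k)).mul_const _
  · refine (hY.mono_exponent hm).of_le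
      ((continuous_eval_const q).comp_aestronglyMeasurable hY.1) ?_
    exact Eventually.of_forall fun ω => (Y ω).norm_coe_le_norm q
  · refine tendsto_of_tendsto_of_tendsto_of_le_of_le tendsto_const_nhds hlim
      (fun _ => zero_le) fun F => ?_
    have hmeas := (aestronglyMeasurable_partialField hB T L a F).sub hY.1
    refine le_trans ?_ (eLpNorm_le_eLpNorm_of_exponent_le hm hmeas)
    refine eLpNorm_mono_ae ?_
    filter_upwards [partialField_ae_eq hB T L a F,
      ae_all_iff.2 fun k : Mode => convMode_ae_eq hB L k t] with ω hω hc
    have : (∑ k ∈ F, a k * convMode P L β k t ω * eigenfunction L k q.2.1 q.2.2) - Y ω q =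
        (partialField T L β a F - Y) ω q := by
      simp only [Pi.sub_apply, ContinuousMap.sub_apply, hω, hc, htq]
    rw [this]
    exact ContinuousMap.norm_coe_le_norm _ q

/-- An exponent that is at least `p` and large enough for the chaining argument. -/
def chainExponent (p δ : ℝ) : ℝ := max p (12 / δ + 1)

/-- Small p falls outside the range of chaining and is reached by monotonicity of L^p norms on a
probability space. -/
lemma eLpNorm_limit_le_of_le [IsProbabilityMeasure P] (hB : ∀ k, IsBrownianReal (β k) P)
    (hind : iIndepFun (fun k ω (t : ℝ≥0) => β k t ω) P) (hT : 0 < T) (hL : 0 < L)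
    {a : Mode → ℝ} {M : ℝ} (ha : ∀ k, |a k| ≤ M) {Y : Ω → C(SpaceTime T L, ℝ)} {m₀ : ℝ≥0∞}
    (hm₀ : m₀ ≠ 0) (hY : AEStronglyMeasurable Y P)
    (hlim : Tendsto (fun F => eLpNorm (partialField T L β a F - Y) m₀ P) atTop (𝓝 0))
    {δ : ℝ} (h0 : 0 < δ) (h1 : δ < 1 / 4) {p : ℝ} (hp : 1 ≤ p) :
    eLpNorm Y (ENNReal.ofReal p) P ≤ fieldConst T L δ (chainExponent p δ) *
      ENNReal.ofReal (√(∑' k, weight L a δ k)) := by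
  have hm : 0 < chainExponent p δ := lt_of_lt_of_le (by linarith) (le_max_left _ _)
  exact (eLpNorm_le_eLpNorm_of_exponent_le (ENNReal.ofReal_le_ofReal (le_max_left _ _)) hY).trans
    (eLpNorm_limit_le hB hind hT hL ha hm₀ hY hlim h0 h1 hm)

/-- The series with bounded coefficients has a continuous version, with all moments bounded. -/
lemma exists_continuousVersion [IsProbabilityMeasure P] (hB : ∀ k, IsBrownianReal (β k) P)
    (hind : iIndepFun (fun k ω (t : ℝ≥0) => β k t ω) P) (hT : 0 < T) (hL : 0 < L)
    {a : Mode → ℝ} {M : ℝ} (ha : ∀ k, |a k| ≤ M) :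
    ∃ Y : Ω → C(SpaceTime T L, ℝ), IsContinuousVersion P T L β a Y ∧
      ∀ p : ℝ, 1 ≤ p → MemLp Y (ENNReal.ofReal p) P ∧
        ∀ δ : ℝ, 0 < δ → δ < 1 / 4 →
          Summable (fun k : Mode => a k ^ 2 * eigenvalue L k ^ (4 * δ - 2)) ∧
          ∫ ω, ‖Y ω‖ ^ p ∂P ≤ (fieldConst T L δ (chainExponent p δ)).toReal ^ p *
            (∑' k : Mode, a k ^ 2 * eigenvalue L k ^ (4 * δ - 2)) ^ (p / 2) := by
  -- Any exponent above the threshold 96 would do.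
  obtain ⟨Y, hY, hlim⟩ := exists_tendsto_partialField hB hind hT hL ha
    (by norm_num : (96 : ℝ) < 97)
  have htop : ∀ p δ : ℝ, 0 < δ → fieldConst T L δ (chainExponent p δ) ≠ ⊤ := fun p δ hδ =>
    fieldConst_ne_top T L hδ (lt_of_lt_of_le (by linarith) (le_max_right _ _))
  have hbound := fun p hp δ h0 h1 => eLpNorm_limit_le_of_le hB hind hT hL ha
    (by simp : ENNReal.ofReal 97 ≠ 0) hY.1 hlim (δ := δ) h0 h1 (p := p) hp
  have hmem : ∀ p : ℝ, 1 ≤ p → MemLp Y (ENNReal.ofReal p) P := fun p hp =>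
    ⟨hY.1, (hbound p hp (1 / 8) (by norm_num) (by norm_num)).trans_lt
      (ENNReal.mul_lt_top (htop p _ (by norm_num)).lt_top ENNReal.ofReal_lt_top)⟩
  refine ⟨Y, isContinuousVersion_of_tendsto hB ?_ hY hlim, fun p hp => ⟨hmem p hp,
    fun δ h0 h1 => ⟨summable_weight hL ha h1, ?_⟩⟩⟩
  · rw [ENNReal.le_ofReal_iff_toReal_le (by simp) (by norm_num)]
    norm_num
  · have hp0 : 0 < p := by linarith
    have hS : 0 ≤ ∑' k, weight L a δ k := tsum_nonneg (weight_nonneg hL a δ)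
    have h := hbound p hp δ h0 h1
    rw [(hmem p hp).eLpNorm_eq_integral_rpow_norm (by simpa using hp0) ENNReal.ofReal_ne_top,
      ENNReal.toReal_ofReal hp0.le, ← ENNReal.ofReal_toReal (htop p δ h0),
      ← ENNReal.ofReal_mul ENNReal.toReal_nonneg,
      ENNReal.ofReal_le_ofReal_iff (by positivity)] at h
    have hI : 0 ≤ ∫ ω, ‖Y ω‖ ^ p ∂P := integral_nonneg fun ω => by positivity
    have h2 := Real.rpow_le_rpow (by positivity) h hp0.le
    rw [← Real.rpow_mul hI, inv_mul_cancel₀ hp0.ne', Real.rpow_one,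
      Real.mul_rpow ENNReal.toReal_nonneg (Real.sqrt_nonneg _), Real.sqrt_eq_rpow,
      ← Real.rpow_mul hS] at h2
    refine h2.trans (le_of_eq ?_)
    congr 2
    ring

end

end SurfaceGrowth

end

theorem mainTheorem6 (T L : ℝ) (hT : 0 < T) (hL : 0 < L) :
    ∃ C : ℝ → ℝ → ℝ,
      ∀ (Ω : Type*) [MeasurableSpace Ω] (P : Measure Ω) [IsProbabilityMeasure P]
        (β : SurfaceGrowth.Mode → ℝ≥0 → Ω → ℝ),
        (∀ k, IsBrownianReal (β k) P) →
        iIndepFun (fun k ω (t : ℝ≥0) => β k t ω) P →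
        ∀ α : ℝ → SurfaceGrowth.Mode → ℝ, SurfaceGrowth.IsRegularization α →
          (∀ k t, SurfaceGrowth.IsWienerIntegral P (β k) t (SurfaceGrowth.kernel L k t)
            (SurfaceGrowth.convMode P L β k t)) ∧
          (∃ Z : Ω → C(SurfaceGrowth.SpaceTime T L, ℝ),
            SurfaceGrowth.IsContinuousVersion P T L β (fun _ => 1) Z ∧
            ∀ p : ℝ, 1 ≤ p → MemLp Z (ENNReal.ofReal p) P) ∧
          ∀ ε : ℝ, 0 < ε →
            ∃ Zε : Ω → C(SurfaceGrowth.SpaceTime T L, ℝ),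
              SurfaceGrowth.IsContinuousVersion P T L β (α ε) Zε ∧
              ∀ p : ℝ, 1 ≤ p →
                MemLp Zε (ENNReal.ofReal p) P ∧
                ∀ δ : ℝ, 0 < δ → δ < 1 / 4 →
                  Summable (fun k : SurfaceGrowth.Mode =>
                    α ε k ^ 2 * SurfaceGrowth.eigenvalue L k ^ (4 * δ - 2)) ∧
                  ∫ ω, ‖Zε ω‖ ^ p ∂P ≤
                    C p δ * (∑' k : SurfaceGrowth.Mode,
                      α ε k ^ 2 * SurfaceGrowth.eigenvalue L k ^ (4 * δ - 2)) ^ (p / 2) := by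
  refine ⟨fun p δ =>
    (SurfaceGrowth.fieldConst T L δ (SurfaceGrowth.chainExponent p δ)).toReal ^ p, ?_⟩
  intro Ω _ P _ β hB hind α hα
  refine ⟨fun k t => SurfaceGrowth.isWienerIntegral_convMode hB L k t, ?_, fun ε hε => ?_⟩
  · obtain ⟨Z, hZ, hp⟩ := SurfaceGrowth.exists_continuousVersion hB hind hT hL
      (a := fun _ => 1) (M := 1) (fun _ => by simp)
    exact ⟨Z, hZ, fun p h => (hp p h).1⟩
  · obtain ⟨M, hM⟩ := hα.bounded
    exact SurfaceGrowth.exists_continuousVersion hB hind hT hL (hM ε hε)
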